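/- Let $p\in(0,1)$ and let $d\ge 2$ be an integer. Consider the discrete-time TASEP with sequential update on $\mathbb Z$: at each time step the particles are processed from right to left, and each particle, independently, jumps to its right neighbouring site with probability $p$ provided that this site is empty at that moment (in particular, it may have just been left by the particle that occupied it). Label the particles by $k\in\mathbb Z$ from right to left and let $x_k(t)$ be the position of particle $k$ at time $t\in\{0,1,2,\dots\}$, with the $d$-periodic initial condition $x_k(0)=-d(k-1)$, $k\in\mathbb Z$. Let $\sigma(1)<\sigma(2)<\dots<\sigma(m)$ be integers and $a_1,\dots,a_m\in\mathbb R$. Then $$\mathbb P\Big(\bigcap_{k=1}^m\{x_{\sigma(k)}(t)\ge a_k\}\Big)=\det(\mathbb 1-\chi_aK\chi_a)_{\ell^2(\{\sigma(1),\dots,\sigma(m)\}\times\mathbb Z)},$$ where $\chi_a(\sigma(k),x)=\mathbb 1(x<a_k)$ and the Fredholm determinant is defined by its (absolutely convergent) expansion $$\det(\mathbb 1-A)_{\ell^2(X)}=\sum_{n\ge 0}\frac{(-1)^n}{n!}\sum_{y_1,\dots,y_n\in X}\det\big[A(y_i,y_j)\big]_{1\le i,j\le n}.$$ The kernel $K$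 is $$K(n_1,x_1;n_2,x_2)=-\binom{x_1-x_2-1}{n_2-n_1-1}+K_0(n_1,x_1;n_2,x_2),$$ where $\binom ab=0$ unless $0\le b\le a$, and $$K_0(n_1,x_1;n_2,x_2)=\frac1{2\pi i}\oint_{\Gamma_0}dv\sum_{i=1}^{d-1}\frac{1+dv}{1+du_i(v)}\,\frac{(1+pu_i(v))^t(-u_i(v))^{n_1}(1+v)^{x_2+n_2-2}}{(1+pv)^t(-v)^{n_2}(1+u_i(v))^{x_1+n_1-1}}.$$ Here, for fixed $v$, $u_0(v)=v,u_1(v),\dots,u_{d-1}(v)$ are the roots in $u$, with multiplicity, of the equation $u(1+u)^{d-1}=v(1+v)^{d-1}$, and $\Gamma_0$ is any piecewise smooth, anticlockwise oriented simple loop enclosing $0$ and neither passing through nor enclosing the other possible poles $-1$ and $-1/p$ of the integrand. -/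

import Mathlib

open MeasureTheory ProbabilityTheory Polynomial Set
open scoped Nat

noncomputable section

namespace SequentialTASEP

/-! ### The dynamics -/

/-- One time step. `x k` is the site of particle `k`, and `ξ k = true` means that the coin of
particle `k` allows it to jump. `Jumps x ξ k` says that particle `k` jumps one site to the right
when the particles are processed from right to left: its coin allows it, and its right neighbouring
site is either empty already, or has just been left by the particle that occupied it. -/
inductive Jumps (x : ℤ → ℤ) (ξ : ℤ → Bool) : ℤ → Prop
  | free (k : ℤ) : ξ k = true → (∀ j, x j ≠ x k + 1) → Jumps x ξ k
  | follow (k j : ℤ) : ξ k = true → x j = x k + 1 → Jumps x ξ j → Jumps x ξ k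

open Classical in
/-- The position `position x₀ ξ t k` of particle `k` at time `t`, when the particles start from
`x₀` and `ξ s k` is the coin of particle `k` for the step from time `s` to time `s + 1`. -/
def position (x₀ : ℤ → ℤ) (ξ : ℕ → ℤ → Bool) : ℕ → ℤ → ℤ
  | 0 => x₀
  | t + 1 => fun k => position x₀ ξ t k + if Jumps (position x₀ ξ t) (ξ t) k then 1 else 0

/-- The `d`-periodic initial configuration; particle `1` starts at the origin and labels increase
from right to left. -/
def periodicStart (d : ℕ) (k : ℤ) : ℤ := -(d : ℤ) * (k - 1)

/-- The coins are independent, and each of them shows `true` with probability `p`. -/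
structure IsCoinField {Ω : Type*} [MeasurableSpace Ω] (μ : Measure Ω) (p : ℝ)
    (ξ : Ω → ℕ → ℤ → Bool) : Prop where
  measurable : ∀ s k, Measurable fun ω => ξ ω s k
  indep : iIndepFun (fun (i : ℕ × ℤ) ω => ξ ω i.1 i.2) μ
  prob : ∀ s k, μ.real {ω | ξ ω s k = true} = p

/-! ### Contours -/

/-- A simple closed curve `γ : [0, 1] → ℂ`, continuously differentiable off a finite set, with
integrable derivative (every piecewise `C¹` simple closed curve is one). -/
structure IsSimpleLoop (γ : ℝ → ℂ) : Prop where
  closed : γ 0 = γ 1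
  continuousOn : ContinuousOn γ (Icc 0 1)
  injOn : InjOn γ (Ico 0 1)
  piecewise : ∃ S : Set ℝ, S.Finite ∧
    ∀ s ∈ Ioo (0 : ℝ) 1 \ S, DifferentiableAt ℝ γ s ∧ ContinuousAt (deriv γ) s
  integrable : IntervalIntegrable (deriv γ) volume 0 1

/-- The contour integral `(1 / 2πi) ∮_γ f(v) dv`. -/
def contourIntegral (γ : ℝ → ℂ) (f : ℂ → ℂ) : ℂ :=
  (2 * (Real.pi : ℂ) * Complex.I)⁻¹ * ∫ s in (0 : ℝ)..1, f (γ s) * deriv γ s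

/-- The winding number of `γ` around `w` (for `w` not on `γ`). -/
def winding (γ : ℝ → ℂ) (w : ℂ) : ℂ := contourIntegral γ fun v => (v - w)⁻¹

/-- `γ` is an anticlockwise simple loop which has `0` in its interior, and `-1` and `-1/p` in its
exterior. -/
structure IsLoopAroundZero (p : ℝ) (γ : ℝ → ℂ) : Prop where
  simple : IsSimpleLoop γ
  avoids : ∀ s ∈ Icc (0 : ℝ) 1, γ s ≠ 0 ∧ γ s ≠ -1 ∧ γ s ≠ -1 / (p : ℂ)
  winding_zero : winding γ 0 = 1
  winding_neg_one : winding γ (-1) = 0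
  winding_neg_inv : winding γ (-1 / (p : ℂ)) = 0

/-! ### The kernel -/

/-- The nontrivial roots `u₁(v), …, u_{d-1}(v)`, with multiplicity: all roots in `u` of
`u (1 + u) ^ (d - 1) = v (1 + v) ^ (d - 1)`, with the trivial root `u = v` removed once. -/
def nontrivialRoots (d : ℕ) (v : ℂ) : Multiset ℂ :=
  (X * (1 + X) ^ (d - 1) - C (v * (1 + v) ^ (d - 1)) : ℂ[X]).roots.erase v

/-- The integrand of the kernel `K₀` as a function of `v`. -/
def integrand (p : ℝ) (d t : ℕ) (n₁ x₁ n₂ x₂ : ℤ) (v : ℂ) : ℂ :=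
  ((nontrivialRoots d v).map fun u =>
    (1 + d * v) / (1 + d * u) *
      (((1 + p * u) ^ t * (-u) ^ n₁ * (1 + v) ^ (x₂ + n₂ - 2)) /
        ((1 + p * v) ^ t * (-v) ^ n₂ * (1 + u) ^ (x₁ + n₁ - 1)))).sum

/-- The kernel `K₀`, computed with the contour `γ`. -/
def kernelZero (p : ℝ) (d t : ℕ) (γ : ℝ → ℂ) (n₁ x₁ n₂ x₂ : ℤ) : ℂ :=
  contourIntegral γ (integrand p d t n₁ x₁ n₂ x₂)

/-- The binomial coefficient `binom (x₁ - x₂ - 1) (n₂ - n₁ - 1)`, with the convention that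
`binom a b` vanishes unless `0 ≤ b ≤ a`. It is the `(n₂ - n₁)`-fold convolution power of the
function `(x₁, x₂) ↦ 1(x₁ > x₂)` when `n₁ < n₂`, and zero otherwise. -/
def binomialTerm (n₁ x₁ n₂ x₂ : ℤ) : ℕ :=
  if n₁ < n₂ ∧ x₂ < x₁ then (x₁ - x₂ - 1).toNat.choose (n₂ - n₁ - 1).toNat else 0

/-- The kernel `K`. -/
def kernel (p : ℝ) (d t : ℕ) (γ : ℝ → ℂ) (n₁ x₁ n₂ x₂ : ℤ) : ℂ :=
  -(binomialTerm n₁ x₁ n₂ x₂ : ℂ) + kernelZero p d t γ n₁ x₁ n₂ x₂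

/-- The kernel of `χ_a K χ_a` on `{σ(1), …, σ(m)} × ℤ`, where `χ_a (σ(k), x) = 1(x < a_k)`. The
point `(σ(k), x)` is written `(k, x)`. -/
def cutKernel (p : ℝ) (d t : ℕ) (γ : ℝ → ℂ) {m : ℕ} (σ : Fin m → ℤ) (a : Fin m → ℝ)
    (y z : Fin m × ℤ) : ℂ :=
  (if (y.2 : ℝ) < a y.1 then 1 else 0) * kernel p d t γ (σ y.1) y.2 (σ z.1) z.2 *
    (if (z.2 : ℝ) < a z.1 then 1 else 0)

/-! ### Fredholm determinants -/

/-- The `n`-th multiple sum `∑_{y₁, …, yₙ} det (A(yᵢ, yⱼ))` of the Fredholm expansion has these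
summands. -/
def fredholmMinor {X : Type*} (A : X → X → ℂ) (n : ℕ) (y : Fin n → X) : ℂ :=
  (Matrix.of fun i j => A (y i) (y j)).det

/-- The Fredholm determinant `det(1 - A)` on `ℓ²(X)`, defined by its expansion
`∑ₙ (-1)ⁿ / n! ∑_{y₁, …, yₙ ∈ X} det (A(yᵢ, yⱼ))`, exists, with all sums absolutely convergent, and
equals `D`. -/
def HasFredholmDet {X : Type*} (A : X → X → ℂ) (D : ℂ) : Prop :=
  (∀ n, Summable (fredholmMinor A n)) ∧
    HasSum (fun n : ℕ => (-1) ^ n / (n ! : ℂ) * ∑' y, fredholmMinor A n y) D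

end SequentialTASEP

end

/-!
The joint distribution of finitely many particles is first written as a finite determinant, and
this is then recognised as the determinant of `1 - χ K χ` on a finite box, outside of which the
minors of the kernel vanish.

*Finitely many particles.* As `d ≥ 2`, a run of adjacent particles has length at most `t + 1` up
to time `t`. So the particles with labels from `l + influence t` on do not notice if all particles
to the right of label `l` are removed (`position_eq_seqPath`). What remains is a system
`x_l > x_{l+1} > … > x_{l+n}`, and only finitely many coins matter.

*The backward equation.* A determinant `det [F i j (y j)]` with `F i j = ∇ (F i (j + 1))`,
where `∇` is `grad`, solves Kolmogorov's backward equation, since the boundary condition makes a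
blocked particle contribute like a free one (`sum_coins_det`).
The indicator of `{α k ≤ y k for all k}` is itself a determinant
of this form, with functions that count chains `z_i > z_{i+1} > … > z_n` which respect the
thresholds `α` (`det_grad_chain`). So the probability is the determinant of the pairing of these
chains with the transition functions of the particles (`sum_table_indicator`).

*The gap formula.* Linear algebra with block matrices turns the determinant of chains that avoid the
region below the thresholds into `det (1 - D K D)`, where `D` is the projection onto that region and
`1 - K` is a block of the inverse of the matrix of the system without thresholds (`det_gap`). It is
not necessary to find the inverse: its rows are determined by linear equations (`row_eq_zero`), and
it suffices that the kernel of the theorem solves them. They are the difference equation in the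
second pair of variables (`kernelZero_sub`), the vanishing of the contour part at the first level,
where the integrand has no pole at the origin (`kernelZero_eq_zero`), and the pairing of the kernel
with the transition functions (`sum_binomialTerm_mul_wave`, `sum_kernelZero_mul_wave`).

*The pairing.* Exponentials `x ↦ (1 + v) ^ x` are eigenfunctions of the evolution and of `∇`. This
reduces the last identity to the integral, against `dV` with `V = -v (1 + v) ^ (d - 1)`, of a sum
of `(-u) ^ a (1 + u) ^ b / (1 + d u)` over the nontrivial roots `u`. Substituting `u` for `v` it is
a residue at `u = -1`, the only other point in the fibre of `0` (`contourIntegral_rootSum`). The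
substitution is made without choosing branches of the roots: both sides satisfy Pascal's rule
in `(a, b)`, hence are determined by their values on a staircase (`eq_zero_of_pascal`), and there
the sum over the roots is given by Lagrange interpolation (`rootSum_base`) up to powers of `V`.

*The Fredholm determinant.* A minor of the cut kernel with a point to the left of the box has a
vanishing row, that of its leftmost point, and a point above its threshold also gives a vanishing
row. So all sums in the expansion are finite, and add up to the determinant on the box
(`hasFredholmDet_of_finite`).
-/

noncomputable section

namespace SequentialTASEP

/-! ### Reduction to finitely many particles -/

/-- One time step of a system with a rightmost particle `0`, which is never blocked. The particles
are updated in the order `0, 1, 2, …`; a particle is blocked if and only if the particle in front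
of it sits, after its own update, on the next site. -/
def seqStep (y : ℕ → ℤ) (c : ℕ → Bool) : ℕ → ℤ
  | 0 => y 0 + if c 0 = true then 1 else 0
  | i + 1 => y (i + 1) + if c (i + 1) = true ∧ seqStep y c i ≠ y (i + 1) + 1 then 1 else 0

/-- The positions at time `s` of the system with a rightmost particle, started from `y`. -/
def seqPath (y : ℕ → ℤ) (c : ℕ → ℕ → Bool) : ℕ → ℕ → ℤ
  | 0 => y
  | s + 1 => seqStep (seqPath y c s) (c s)

lemma le_seqStep (y : ℕ → ℤ) (c : ℕ → Bool) (i : ℕ) : y i ≤ seqStep y c i := by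
  cases i <;> simp only [seqStep] <;> split_ifs <;> omega

lemma seqStep_le (y : ℕ → ℤ) (c : ℕ → Bool) (i : ℕ) : seqStep y c i ≤ y i + 1 := by
  cases i <;> simp only [seqStep] <;> split_ifs <;> omega

lemma le_seqPath (y : ℕ → ℤ) (c : ℕ → ℕ → Bool) (s i : ℕ) : y i ≤ seqPath y c s i := by
  induction s with
  | zero => exact le_rfl
  | succ s ih => exact ih.trans (le_seqStep _ _ _)

lemma seqPath_le (y : ℕ → ℤ) (c : ℕ → ℕ → Bool) (s i : ℕ) : seqPath y c s i ≤ y i + s := by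
  induction s with
  | zero => simp [seqPath]
  | succ s ih =>
    have := seqStep_le (seqPath y c s) (c s) i
    simp only [seqPath]; push_cast; omega

lemma strictAnti_seqStep {y : ℕ → ℤ} (hy : StrictAnti y) (c : ℕ → Bool) :
    StrictAnti (seqStep y c) := by
  refine strictAnti_nat_of_succ_lt fun i => ?_
  have h1 := le_seqStep y c i
  have h2 := hy (Nat.lt_succ_self i)
  simp only [Nat.succ_eq_add_one] at h2
  simp only [seqStep]
  split_ifs with h
  · have := h.2; omega
  · omega

lemma strictAnti_seqPath {y : ℕ → ℤ} (hy : StrictAnti y) (c : ℕ → ℕ → Bool) (s : ℕ) :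
    StrictAnti (seqPath y c s) := by
  induction s with
  | zero => exact hy
  | succ s ih => exact strictAnti_seqStep ih _

lemma seqStep_congr (y : ℕ → ℤ) {c c' : ℕ → Bool} {i : ℕ} (h : ∀ j ≤ i, c j = c' j) :
    seqStep y c i = seqStep y c' i := by
  induction i with
  | zero => simp [seqStep, h 0 le_rfl]
  | succ i ih => simp [seqStep, h (i + 1) le_rfl, ih fun j hj => h j (by omega)]

lemma seqStep_congr_left {y y' : ℕ → ℤ} (c : ℕ → Bool) {i : ℕ} (h : ∀ j ≤ i, y j = y' j) :
    seqStep y c i = seqStep y' c i := by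
  induction i with
  | zero => simp [seqStep, h 0 le_rfl]
  | succ i ih => simp [seqStep, h (i + 1) le_rfl, ih fun j hj => h j (by omega)]

lemma seqPath_congr (y : ℕ → ℤ) {c c' : ℕ → ℕ → Bool} {s i : ℕ}
    (h : ∀ r < s, ∀ j ≤ i, c r j = c' r j) : seqPath y c s i = seqPath y c' s i := by
  induction s generalizing i with
  | zero => rfl
  | succ s ih =>
    simp only [seqPath]
    rw [seqStep_congr _ (h s (Nat.lt_succ_self s))]
    exact seqStep_congr_left _ fun j hj => ih fun r hr k hk => h r (by omega) k (by omega)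

lemma seqPath_succ_left (y : ℕ → ℤ) (c : ℕ → ℕ → Bool) (s : ℕ) :
    seqPath y c (s + 1) = seqPath (seqStep y (c 0)) (fun r => c (r + 1)) s := by
  induction s with
  | zero => rfl
  | succ s ih => rw [seqPath, ih]; rfl

open Classical in
/-- In a strictly decreasing configuration, a particle jumps exactly when its coin allows it and
the particle in front of it is not, after its own update, on the next site. -/
lemma jumps_iff {x : ℤ → ℤ} (hx : StrictAnti x) (ξ : ℤ → Bool) (k : ℤ) :
    Jumps x ξ k ↔ ξ k = true ∧ x (k - 1) + (if Jumps x ξ (k - 1) then 1 else 0) ≠ x k + 1 := by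
  have h1 : x k < x (k - 1) := hx (by omega)
  have key : ∀ j, x j = x k + 1 → j = k - 1 := by
    intro j hj
    have h2 : j < k := hx.lt_iff_gt.1 (by omega)
    have h3 : x j ≤ x (k - 1) := by omega
    have h4 := hx.le_iff_ge.1 h3
    omega
  constructor
  · rintro (⟨_, h, h'⟩ | ⟨_, j, h, hj, hJ⟩)
    · refine ⟨h, ?_⟩
      have := h' (k - 1)
      split_ifs <;> omega
    · obtain rfl := key j hj
      refine ⟨h, ?_⟩
      rw [if_pos hJ]; omega
  · rintro ⟨h, h'⟩
    by_cases hj : ∃ j, x j = x k + 1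
    · obtain ⟨j, hj⟩ := hj
      obtain rfl := key j hj
      refine .follow k _ h hj ?_
      by_contra hJ
      rw [if_neg hJ] at h'; omega
    · exact .free k h (by simpa using hj)

lemma le_position (x₀ : ℤ → ℤ) (ξ : ℕ → ℤ → Bool) (s : ℕ) (k : ℤ) :
    x₀ k ≤ position x₀ ξ s k := by
  induction s with
  | zero => exact le_rfl
  | succ s ih => simp only [position]; split_ifs <;> omega

lemma position_le (x₀ : ℤ → ℤ) (ξ : ℕ → ℤ → Bool) (s : ℕ) (k : ℤ) :
    position x₀ ξ s k ≤ x₀ k + s := by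
  induction s with
  | zero => simp [position]
  | succ s ih => simp only [position]; push_cast; split_ifs <;> omega

lemma strictAnti_position {x₀ : ℤ → ℤ} (hx : StrictAnti x₀) (ξ : ℕ → ℤ → Bool) (s : ℕ) :
    StrictAnti (position x₀ ξ s) := by
  classical
  induction s with
  | zero => exact hx
  | succ s ih =>
    refine strictAnti_int_of_succ_lt fun k => ?_
    have h1 := jumps_iff ih (ξ s) (k + 1)
    have h2 : position x₀ ξ s (k + 1) < position x₀ ξ s k := ih (by omega)
    rw [add_sub_cancel_right] at h1
    simp only [position]
    by_cases h : Jumps (position x₀ ξ s) (ξ s) (k + 1)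
    · have h3 := (h1.1 h).2
      rw [if_pos h]
      split_ifs at h3 ⊢ <;> omega
    · rw [if_neg h]
      split_ifs <;> omega

lemma strictAnti_periodicStart {d : ℕ} (hd : 2 ≤ d) : StrictAnti (periodicStart d) := by
  intro a b hab
  simp only [periodicStart]
  have : (0 : ℤ) < d := by omega
  nlinarith

/-- In time `s`, the particles in front of particle `0` influence only the particles with labels
below `influence s`. -/
def influence : ℕ → ℕ
  | 0 => 0
  | s + 1 => influence s + s + 1

/-- Dropping the particles to the right of label `l` does not change the motion of the particles
with labels from `l + influence s` on, up to time `s`. Because of the gaps in the initial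
configuration, a run of adjacent particles has at most `s + 1` members at time `s`, and blocking
can be passed on only along such a run. -/
lemma position_eq_seqPath {d : ℕ} (hd : 2 ≤ d) (ξ : ℕ → ℤ → Bool) (l : ℤ) (s : ℕ) (i : ℕ)
    (hi : influence s ≤ i) :
    position (periodicStart d) ξ s (l + i) =
      seqPath (fun i => periodicStart d (l + i)) (fun r i => ξ r (l + i)) s i := by
  classical
  induction s generalizing i with
  | zero => rfl
  | succ s ih =>
    set x := position (periodicStart d) ξ s with hxdef
    have hx : StrictAnti x := strictAnti_position (strictAnti_periodicStart hd) ξ s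
    set y := seqPath (fun i => periodicStart d (l + i)) (fun r i => ξ r (l + i)) s with hy
    have hxb : ∀ k, periodicStart d k ≤ x k ∧ x k ≤ periodicStart d k + s :=
      fun k => ⟨le_position _ _ _ _, position_le _ _ _ _⟩
    -- If the two dynamics move particle `influence s + r` differently in this step, then all
    -- particles between `influence s` and this one are adjacent.
    have key : ∀ r : ℕ, position (periodicStart d) ξ (s + 1) (l + (influence s + r : ℕ)) ≠
        seqStep y (fun i => ξ s (l + i)) (influence s + r) →
        x (l + influence s) = x (l + (influence s + r : ℕ)) + r := by
      intro r
      induction r with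
      | zero => simp
      | succ r ihr =>
        intro hne
        have e1 : l + (influence s + (r + 1) : ℕ) - 1 = l + (influence s + r : ℕ) := by
          push_cast; ring
        have hJ := jumps_iff hx (ξ s) (l + (influence s + (r + 1) : ℕ))
        rw [e1] at hJ
        have e2 : y (influence s + (r + 1)) = x (l + (influence s + (r + 1) : ℕ)) :=
          (ih _ (by omega)).symm
        have e3 : y (influence s + r) = x (l + (influence s + r : ℕ)) :=
          (ih _ (by omega)).symm
        have hlt : x (l + (influence s + (r + 1) : ℕ)) < x (l + (influence s + r : ℕ)) :=
          hx (by push_cast; omega)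
        have hb1 := le_seqStep y (fun i => ξ s (l + i)) (influence s + r)
        have hb2 := seqStep_le y (fun i => ξ s (l + i)) (influence s + r)
        simp only [position, ← hxdef] at hne ihr
        rw [← Nat.add_assoc, seqStep, Nat.add_assoc, e2] at hne
        by_cases hr : x (l + (influence s + r : ℕ)) +
            (if Jumps x (ξ s) (l + (influence s + r : ℕ)) then 1 else 0) =
            seqStep y (fun i => ξ s (l + i)) (influence s + r)
        · exfalso
          apply hne
          rw [← hr]
          simp only [hJ]
        · have h4 := ihr hr
          rw [h4]
          push_cast
          by_contra hgap
          apply hne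
          have hg : x (l + (influence s + (r + 1) : ℕ)) + 1 < x (l + (influence s + r : ℕ)) := by
            push_cast at *; omega
          congr 1
          have hc1 : x (l + (influence s + r : ℕ)) +
              (if Jumps x (ξ s) (l + (influence s + r : ℕ)) then 1 else 0) ≠
                x (l + (influence s + (r + 1) : ℕ)) + 1 := by split_ifs <;> omega
          have hc2 : seqStep y (fun i => ξ s (l + i)) (influence s + r) ≠
                x (l + (influence s + (r + 1) : ℕ)) + 1 := by omega
          simp only [hJ, ne_eq, hc1, hc2, not_false_eq_true, and_true]
    simp only [influence] at hi
    obtain ⟨r, rfl⟩ := Nat.exists_eq_add_of_le (show influence s ≤ i by omega)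
    by_contra hne
    have h := key r hne
    have h1 := (hxb (l + influence s)).1
    have h2 := (hxb (l + (influence s + r : ℕ))).2
    simp only [periodicStart] at h1 h2
    push_cast at h h1 h2
    have h3 : (s : ℤ) + 1 ≤ r := by omega
    have h4 : (2 : ℤ) ≤ d := by exact_mod_cast hd
    nlinarith

/-! ### The law of finitely many coins -/

/-- The weight of the outcome of one coin. -/
def coinWeight (p : ℝ) (b : Bool) : ℂ := if b then p else 1 - p

/-- The coins of a finite table, extended by `false`. -/
def extendCoins {N : ℕ} (c : Fin N → Bool) (i : ℕ) : Bool := if h : i < N then c ⟨i, h⟩ else false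

/-- The probability of an event that depends on finitely many coins is the sum of the weights of
the favourable outcomes. -/
lemma measureReal_eq_sum_coins {Ω : Type*} [MeasurableSpace Ω] (μ : Measure Ω)
    [IsProbabilityMeasure μ] {p : ℝ} {ξ : Ω → ℕ → ℤ → Bool} (hξ : IsCoinField μ p ξ) (t N : ℕ)
    (l : ℤ) (Q : (Fin t → Fin N → Bool) → Prop) [DecidablePred Q] :
    ((μ.real {ω | Q fun s i => ξ ω s (l + (i : ℕ))} : ℝ) : ℂ) =
      ∑ c, (∏ s, ∏ i, coinWeight p (c s i)) * if Q c then 1 else 0 := by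
  classical
  let tab : Ω → Fin t → Fin N → Bool := fun ω s i => ξ ω s (l + (i : ℕ))
  have hmeas : ∀ c : Fin t → Fin N → Bool,
      MeasurableSet {ω | tab ω = c} := by
    intro c
    have : {ω | tab ω = c} =
        ⋂ s : Fin t, ⋂ i : Fin N, (fun ω => ξ ω s (l + (i : ℕ))) ⁻¹' {c s i} := by
      ext ω; simp [funext_iff, tab]
    rw [this]
    exact .iInter fun s => .iInter fun i => hξ.measurable _ _ (measurableSet_singleton _)
  have hone : ∀ (s : ℕ) (k : ℤ) (b : Bool),
      ((μ.real ((fun ω => ξ ω s k) ⁻¹' {b}) : ℝ) : ℂ) = coinWeight p b := by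
    intro s k b
    have htrue : μ.real ((fun ω => ξ ω s k) ⁻¹' {true}) = p := hξ.prob s k
    cases b
    · have : (fun ω => ξ ω s k) ⁻¹' {false} = ((fun ω => ξ ω s k) ⁻¹' {true})ᶜ := by
        ext ω; simp
      rw [this, probReal_compl_eq_one_sub (hξ.measurable s k (measurableSet_singleton _)), htrue]
      simp [coinWeight]
    · rw [htrue]; simp [coinWeight]
  have hw : ∀ c : Fin t → Fin N → Bool,
      ((μ.real {ω | tab ω = c} : ℝ) : ℂ) =
        ∏ s, ∏ i, coinWeight p (c s i) := by
    intro c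
    let e : Fin t × Fin N ↪ ℕ × ℤ := ⟨fun q => (q.1, l + (q.2 : ℕ)), by
      rintro ⟨a, b⟩ ⟨a', b'⟩ h
      simp only [Prod.mk.injEq] at h
      have h1 := h.1
      have h2 := h.2
      ext <;> simp <;> omega⟩
    have hind := hξ.indep.precomp e.injective
    have h := hind.measure_inter_preimage_eq_mul Finset.univ
      (sets := fun q => {c q.1 q.2}) (fun _ _ => measurableSet_singleton _)
    have hset : {ω | tab ω = c} =
        ⋂ q ∈ (Finset.univ : Finset (Fin t × Fin N)),
          (fun ω => ξ ω (e q).1 (e q).2) ⁻¹' {c q.1 q.2} := by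
      ext ω; simp only [tab, funext_iff, mem_ofPred_eq, mem_iInter, Finset.mem_univ, true_imp_iff,
        mem_preimage, mem_singleton_iff, Prod.forall]; rfl
    rw [hset, Measure.real]
    rw [h, ENNReal.toReal_prod, Complex.ofReal_prod, ← Finset.univ_product_univ,
      Finset.prod_product]
    exact Finset.prod_congr rfl fun s _ => Finset.prod_congr rfl fun i _ => hone _ _ _
  have hunion : {ω | Q fun s i => ξ ω s (l + (i : ℕ))} =
      ⋃ c ∈ (Finset.univ.filter Q), {ω | tab ω = c} := by
    ext ω; simp [tab]
  rw [hunion, measureReal_biUnion_finset _ (fun c _ => hmeas c)]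
  · rw [Complex.ofReal_sum, Finset.sum_filter]
    refine Finset.sum_congr rfl fun c _ => ?_
    rw [hw]; split_ifs <;> simp
  · intro c _ c' _ hne
    refine Set.disjoint_left.2 fun ω h h' => hne ?_
    simp only [mem_ofPred_eq] at h h'
    rw [← h, ← h']

/-! ### Averaging over the coins -/

lemma coinWeight_add (p : ℝ) : coinWeight p true + coinWeight p false = 1 := by
  simp [coinWeight]

lemma sum_prod_coinWeight {ι : Type*} [Fintype ι] [DecidableEq ι] (p : ℝ) :
    ∑ c : ι → Bool, ∏ i, coinWeight p (c i) = 1 := by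
  rw [← Fintype.piFinset_univ, ← Finset.prod_univ_sum]
  simp [coinWeight_add]

/-- One coin may be averaged over separately. -/
lemma sum_coins_update {ι : Type*} [Fintype ι] [DecidableEq ι] (p : ℝ) (k : ι)
    (F : (ι → Bool) → ℂ) :
    ∑ c, (∏ i, coinWeight p (c i)) * F c =
      ∑ c, (∏ i, coinWeight p (c i)) * (coinWeight p true * F (Function.update c k true) +
        coinWeight p false * F (Function.update c k false)) := by
  have h1 : ∀ c : ι → Bool, (∏ i, coinWeight p (c i)) * F c =
      ∑ b, (∏ i, coinWeight p (c i)) * coinWeight p b * F c := by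
    intro c
    rw [Fintype.sum_bool, ← add_mul, ← mul_add, coinWeight_add, mul_one]
  have h2 : ∀ c : ι → Bool, (∏ i, coinWeight p (c i)) *
      (coinWeight p true * F (Function.update c k true) +
        coinWeight p false * F (Function.update c k false)) =
      ∑ b, (∏ i, coinWeight p (c i)) * coinWeight p b * F (Function.update c k b) := by
    intro c
    rw [Fintype.sum_bool]; ring
  simp_rw [h1, h2]
  rw [← Fintype.sum_prod_type', ← Fintype.sum_prod_type']
  have hinv : ∀ q : (ι → Bool) × Bool,
      (Function.update (Function.update q.1 k q.2) k (q.1 k),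
        (Function.update q.1 k q.2) k) = q := by
    rintro ⟨c, b⟩; simp
  let e : (ι → Bool) × Bool ≃ (ι → Bool) × Bool :=
    ⟨fun q => (Function.update q.1 k q.2, q.1 k), fun q => (Function.update q.1 k q.2, q.1 k),
      hinv, hinv⟩
  refine (Fintype.sum_equiv e _ _ ?_).symm
  rintro ⟨c, b⟩
  simp only [e, Equiv.coe_fn_mk]
  rw [← Finset.mul_prod_erase _ _ (Finset.mem_univ k),
    ← Finset.mul_prod_erase _ (fun i => coinWeight p (Function.update c k b i))
      (Finset.mem_univ k)]
  have : ∏ i ∈ Finset.univ.erase k, coinWeight p (Function.update c k b i) =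
      ∏ i ∈ Finset.univ.erase k, coinWeight p (c i) := by
    refine Finset.prod_congr rfl fun i hi => ?_
    rw [Function.update_of_ne (Finset.ne_of_mem_erase hi)]
  rw [this]
  simp only [Function.update_self]
  ring

/-- The backward difference `f (x - 1) - f x`. -/
def grad : Module.End ℂ (ℤ → ℂ) where
  toFun f x := f (x - 1) - f x
  map_add' f g := by ext x; simp; ring
  map_smul' c f := by ext x; simp; ring

/-- The transition operator of a single free particle: the mean of `f` after one step. -/
def hop (p : ℝ) : Module.End ℂ (ℤ → ℂ) where
  toFun f x := (1 - p) * f x + p * f (x + 1)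
  map_add' f g := by ext x; simp; ring
  map_smul' c f := by ext x; simp; ring

lemma grad_apply (f : ℤ → ℂ) (x : ℤ) : grad f x = f (x - 1) - f x := rfl

lemma hop_apply (p : ℝ) (f : ℤ → ℂ) (x : ℤ) : hop p f x = (1 - p) * f x + p * f (x + 1) := rfl

lemma commute_hop_grad (p : ℝ) : Commute (hop p) grad := by
  refine LinearMap.ext fun f => funext fun x => ?_
  simp only [Module.End.mul_apply, grad_apply, hop_apply]
  rw [show x - 1 + 1 = x + 1 - 1 by ring]
  ring

/-- Kolmogorov's backward equation for one step, solved by a determinant. The boundary condition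
`F i j = grad (F i (j + 1))` makes a particle that is blocked contribute as if it were free. -/
lemma sum_coins_det {N : ℕ} (p : ℝ) (y : ℕ → ℤ) (F : Fin N → Fin N → ℤ → ℂ)
    (hF : ∀ i (j j' : Fin N), (j' : ℕ) = j + 1 → F i j = grad (F i j')) :
    ∑ c : Fin N → Bool, (∏ i, coinWeight p (c i)) *
      (Matrix.of fun i j => F i j (seqStep y (extendCoins c) j)).det =
      (Matrix.of fun i j : Fin N => hop p (F i j) (y j)).det := by
  -- Interpolate: the columns `j < m` are evaluated after the step, the others are averaged.
  let M : ℕ → (Fin N → Bool) → Matrix (Fin N) (Fin N) ℂ := fun m c => .of fun i j =>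
    if (j : ℕ) < m then F i j (seqStep y (extendCoins c) j) else hop p (F i j) (y j)
  have hstep : ∀ m, m < N → ∑ c : Fin N → Bool, (∏ i, coinWeight p (c i)) * (M (m + 1) c).det =
      ∑ c : Fin N → Bool, (∏ i, coinWeight p (c i)) * (M m c).det := by
    intro m hm
    rw [sum_coins_update p ⟨m, hm⟩]
    refine Finset.sum_congr rfl fun c _ => ?_
    congr 1
    have hext : ∀ b, ∀ i < m, extendCoins (Function.update c ⟨m, hm⟩ b) i = extendCoins c i := by
      intro b i hi
      simp only [extendCoins]
      rw [dif_pos (by omega), dif_pos (by omega), Function.update_of_ne]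
      simp; omega
    have hextm : ∀ b, extendCoins (Function.update c ⟨m, hm⟩ b) m = b := by
      intro b; simp [extendCoins, hm]
    have hz : ∀ b, ∀ i < m, seqStep y (extendCoins (Function.update c ⟨m, hm⟩ b)) i =
        seqStep y (extendCoins c) i :=
      fun b i hi => seqStep_congr _ fun j hj => hext b j (by omega)
    have hM : ∀ b, M (m + 1) (Function.update c ⟨m, hm⟩ b) = (M m c).updateCol ⟨m, hm⟩
        fun i => F i ⟨m, hm⟩ (seqStep y (extendCoins (Function.update c ⟨m, hm⟩ b)) m) := by
      intro b
      ext i j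
      rw [Matrix.updateCol_apply]
      simp only [M, Matrix.of_apply]
      rcases lt_trichotomy (j : ℕ) m with h | h | h
      · rw [if_pos (by omega), if_neg (by simp [Fin.ext_iff]; omega), if_pos h, hz b _ h]
      · obtain rfl : j = ⟨m, hm⟩ := Fin.ext h
        simp
      · rw [if_neg (by omega), if_neg (by simp [Fin.ext_iff]; omega), if_neg (by omega)]
    have hM0 : M m c = (M m c).updateCol ⟨m, hm⟩ fun i => hop p (F i ⟨m, hm⟩) (y m) := by
      ext i j
      rw [Matrix.updateCol_apply]
      split_ifs with h
      · subst h; simp [M]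
      · rfl
    rw [hM, hM]
    -- Either the coin of particle `m` decides, or the particle is blocked.
    have hfree : (∀ b, seqStep y (extendCoins (Function.update c ⟨m, hm⟩ b)) m =
        y m + if b = true then 1 else 0) ∨
        ((∀ b, seqStep y (extendCoins (Function.update c ⟨m, hm⟩ b)) m = y m) ∧
          ∃ m', m = m' + 1 ∧ seqStep y (extendCoins c) m' = y m + 1) := by
      cases m with
      | zero => left; intro b; rw [seqStep, hextm]
      | succ m' =>
        by_cases hb : seqStep y (extendCoins c) m' = y (m' + 1) + 1
        · right
          refine ⟨fun b => ?_, m', rfl, hb⟩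
          rw [seqStep, hz b m' (by omega), if_neg (by tauto), add_zero]
        · left
          intro b
          rw [seqStep, hz b m' (by omega), hextm]
          simp [hb]
    rcases hfree with h | ⟨h, m', rfl, hb⟩
    · rw [h, h, hM0, Matrix.updateCol_idem, Matrix.updateCol_idem]
      have : (fun i => hop p (F i ⟨m, hm⟩) (y m)) =
          (coinWeight p true • fun i => F i ⟨m, hm⟩ (y m + 1)) +
            (coinWeight p false • fun i => F i ⟨m, hm⟩ (y m)) := by
        ext i; simp [hop_apply, coinWeight]; ring
      rw [this, Matrix.det_updateCol_add, Matrix.det_updateCol_smul, Matrix.det_updateCol_smul]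
      simp
    -- If it is blocked, the averaged column differs from the column at rest by a multiple of the
    -- column of the blocking particle.
    · rw [h, h, ← add_mul, coinWeight_add, one_mul]
      conv_rhs => rw [hM0]
      set A := (M (m' + 1) c).updateCol ⟨m' + 1, hm⟩ fun i => F i ⟨m' + 1, hm⟩ (y (m' + 1)) with hA
      have hne : (⟨m' + 1, hm⟩ : Fin N) ≠ ⟨m', by omega⟩ := by simp
      rw [← Matrix.det_updateCol_add_smul_self A hne (-(p : ℂ)), hA, Matrix.updateCol_idem]
      congr 2
      ext i
      rw [Matrix.updateCol_self, Matrix.updateCol_ne hne.symm]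
      simp only [M, Matrix.of_apply, Nat.lt_succ_self, if_true, hb]
      rw [hF i ⟨m', by omega⟩ ⟨m' + 1, hm⟩ rfl, grad_apply, hop_apply, add_sub_cancel_right,
        smul_eq_mul]
      ring
  have hall : ∀ m, m ≤ N → ∑ c : Fin N → Bool, (∏ i, coinWeight p (c i)) * (M m c).det =
      ∑ c : Fin N → Bool, (∏ i, coinWeight p (c i)) * (M 0 c).det := by
    intro m
    induction m with
    | zero => simp
    | succ m ih => intro hm; rw [hstep m (by omega), ih (by omega)]
  have hN := hall N le_rfl
  have e1 : ∀ c, M N c = Matrix.of fun i j : Fin N => F i j (seqStep y (extendCoins c) j) := by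
    intro c; ext i j; simp [M]
  have e0 : ∀ c, M 0 c = Matrix.of fun i j : Fin N => hop p (F i j) (y j) := by
    intro c; ext i j; simp [M]
  simp only [e1, e0] at hN
  rw [hN, ← Finset.sum_mul, sum_prod_coinWeight, one_mul]

/-- A finite table of coins for several time steps, extended by `false`. -/
def extendTable {t N : ℕ} (c : Fin t → Fin N → Bool) (s i : ℕ) : Bool :=
  if h : s < t then extendCoins (c ⟨s, h⟩) i else false

/-- Kolmogorov's backward equation, iterated over `t` steps. -/
lemma sum_table_det {N : ℕ} (p : ℝ) (g : Fin N → ℤ → ℂ) (t : ℕ) (y : ℕ → ℤ) :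
    ∑ c : Fin t → Fin N → Bool, (∏ s, ∏ i, coinWeight p (c s i)) *
      (Matrix.of fun i j : Fin N =>
        (grad ^ (N - 1 - j : ℕ)) (g i) (seqPath y (extendTable c) t j)).det =
      (Matrix.of fun i j : Fin N => (hop p ^ t * grad ^ (N - 1 - j : ℕ)) (g i) (y j)).det := by
  induction t generalizing y with
  | zero => simp [seqPath]
  | succ t ih =>
    rw [← (Fin.consEquiv fun _ => Fin N → Bool).sum_comp, Fintype.sum_prod_type]
    have hpath : ∀ (c₀ : Fin N → Bool) (c : Fin t → Fin N → Bool) (i : ℕ),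
        seqPath y (extendTable (Fin.cons c₀ c : Fin (t + 1) → Fin N → Bool)) (t + 1) i =
          seqPath (seqStep y (extendCoins c₀)) (extendTable c) t i := by
      intro c₀ c i
      rw [seqPath_succ_left]
      have : extendTable (Fin.cons c₀ c : Fin (t + 1) → Fin N → Bool) 0 = extendCoins c₀ := by
        ext i; simp [extendTable]
      rw [this]
      refine seqPath_congr _ fun r hr j _ => ?_
      simp only [extendTable]
      rw [dif_pos (by omega), dif_pos hr]
      rfl
    have hcons : ∀ (c₀ : Fin N → Bool) (c : Fin t → Fin N → Bool),
        (Fin.consEquiv fun _ => Fin N → Bool) (c₀, c) =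
          (Fin.cons c₀ c : Fin (t + 1) → Fin N → Bool) := fun _ _ => rfl
    simp only [hcons, Fin.prod_univ_succ, Fin.cons_zero, Fin.cons_succ, hpath,
      mul_assoc]
    simp only [← Finset.mul_sum, ih]
    rw [sum_coins_det p y fun i j => (hop p ^ t * grad ^ (N - 1 - j : ℕ)) (g i)]
    · simp only [← Module.End.mul_apply, ← mul_assoc, ← pow_succ']
    · intro i j j' h
      rw [← Module.End.mul_apply, ← mul_assoc, (commute_hop_grad p).pow_left t |>.symm.eq,
        mul_assoc, ← pow_succ', show N - 1 - (j : ℕ) = N - 1 - j' + 1 by omega]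

/-! ### The indicator of the event as a determinant -/

lemma grad_pow_congr {f g : ℤ → ℂ} (k : ℕ) {x : ℤ} (h : ∀ z, x - k ≤ z → z ≤ x → f z = g z) :
    (grad ^ k) f x = (grad ^ k) g x := by
  induction k generalizing x with
  | zero => exact h x (by simp) le_rfl
  | succ k ih =>
    simp only [pow_succ', Module.End.mul_apply, grad_apply]
    push_cast at h
    rw [ih fun z h1 h2 => h z (by omega) (by omega), ih fun z h1 h2 => h z (by omega) (by omega)]

lemma hop_pow_congr (p : ℝ) {f g : ℤ → ℂ} (t : ℕ) {x : ℤ}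
    (h : ∀ z, x ≤ z → z ≤ x + t → f z = g z) : (hop p ^ t) f x = (hop p ^ t) g x := by
  induction t generalizing x with
  | zero => exact h x le_rfl (by simp)
  | succ t ih =>
    simp only [pow_succ', Module.End.mul_apply, hop_apply]
    push_cast at h
    rw [ih fun z h1 h2 => h z (by omega) (by omega), ih fun z h1 h2 => h z (by omega) (by omega)]

/-- `chain L α n i y` counts the chains `L > z i > z (i + 1) > … > z n = y` with `z k ≥ α k` for
all `k`; it vanishes if `n < i`. -/
def chain (L : ℤ) (α : ℕ → ℤ) : ℕ → ℕ → ℤ → ℂ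
  | 0, i, y => if α 0 ≤ y then (if i = 0 then 1 else 0) else 0
  | n + 1, i, y => if α (n + 1) ≤ y then
      (if i = n + 1 then 1 else 0) + ∑ z ∈ Finset.Ioo y L, chain L α n i z else 0

lemma chain_of_lt (L : ℤ) (α : ℕ → ℤ) {n i : ℕ} (h : n < i) (y : ℤ) : chain L α n i y = 0 := by
  induction n generalizing y with
  | zero => simp [chain, show i ≠ 0 by omega]
  | succ n ih =>
    simp only [chain]
    rw [if_neg (show i ≠ n + 1 by omega), Finset.sum_eq_zero fun z _ => ih (by omega) z]
    simp

lemma chain_of_not_le (L : ℤ) (α : ℕ → ℤ) {n : ℕ} (i : ℕ) {y : ℤ} (h : ¬ α n ≤ y) :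
    chain L α n i y = 0 := by
  cases n <;> simp [chain, h]

lemma chain_self (L : ℤ) (α : ℕ → ℤ) {n : ℕ} {y : ℤ} (h : α n ≤ y) : chain L α n n y = 1 := by
  cases n with
  | zero => simp [chain, h]
  | succ n =>
    simp only [chain]
    rw [if_pos h, Finset.sum_eq_zero fun z _ => chain_of_lt L α (Nat.lt_succ_self n) z]
    simp

lemma sum_Ioo_sub_one {x L : ℤ} (hx : x < L) (f : ℤ → ℂ) :
    ∑ z ∈ Finset.Ioo (x - 1) L, f z = f x + ∑ z ∈ Finset.Ioo x L, f z := by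
  have : Finset.Ioo (x - 1) L = insert x (Finset.Ioo x L) := by
    ext w; simp; omega
  rw [this, Finset.sum_insert (by simp)]

lemma grad_chain {L : ℤ} {α : ℕ → ℤ} {n i : ℕ} (hi : i ≤ n) {z : ℤ} (h1 : α (n + 1) ≤ z - 1)
    (h2 : z < L) : grad (chain L α (n + 1) i) z = chain L α n i z := by
  rw [grad_apply]
  simp only [chain]
  rw [if_pos h1, if_pos (show α (n + 1) ≤ z by omega), if_neg (show i ≠ n + 1 by omega)]
  rw [sum_Ioo_sub_one h2]
  ring

lemma add_le_of_strictAnti {y : ℕ → ℤ} (hy : StrictAnti y) (j r : ℕ) : y (j + r) + r ≤ y j := by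
  induction r with
  | zero => simp
  | succ r ih =>
    have := hy (show j + r < j + (r + 1) by omega)
    push_cast; omega

/-- The indicator of `α k ≤ y k` for all `k ≤ n` is a determinant of the shape that solves
Kolmogorov's backward equation. Its last row is `(0, …, 0, 1)`: only the chain of length one starts
at the last level, and it is constant above the threshold. -/
lemma det_grad_chain {L : ℤ} (α : ℕ → ℤ) {y : ℕ → ℤ} (hy : StrictAnti y) (hL : y 0 < L) (n : ℕ) :
    (Matrix.of fun i j : Fin (n + 1) => (grad ^ (n - j : ℕ)) (chain L α n i) (y j)).det =
      if ∀ k ≤ n, α k ≤ y k then 1 else 0 := by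
  induction n with
  | zero => simp [chain]
  | succ n ih =>
    by_cases hα : α (n + 1) ≤ y (n + 1)
    · have hbound : ∀ j : ℕ, j ≤ n → y (n + 1) + (n + 1 - j : ℕ) ≤ y j := by
        intro j hj
        have := add_le_of_strictAnti hy j (n + 1 - j)
        rwa [show j + (n + 1 - j) = n + 1 by omega] at this
      have hlt : ∀ j, y j < L := fun j => (hy.antitone (Nat.zero_le j)).trans_lt hL
      have hrow : ∀ j : Fin (n + 1 + 1), j ≠ Fin.last (n + 1) →
          (grad ^ (n + 1 - j : ℕ)) (chain L α (n + 1) (Fin.last (n + 1) : Fin (n + 1 + 1)))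
            (y j) = 0 := by
        intro j hj
        have hj' : (j : ℕ) ≤ n := by
          have := Fin.val_lt_last hj; omega
        rw [grad_pow_congr (g := fun _ => 1), show n + 1 - (j : ℕ) = n - j + 1 by omega, pow_succ,
          Module.End.mul_apply]
        · have : grad (fun _ : ℤ => (1 : ℂ)) = 0 := by ext x; simp [grad_apply]
          rw [this, map_zero]; rfl
        · intro z hz _
          have := hbound j hj'
          exact chain_self L α (by omega)
      rw [Matrix.det_succ_row _ (Fin.last (n + 1)), Finset.sum_eq_single (Fin.last (n + 1))]
      · simp only [Matrix.of_apply, Fin.val_last, Nat.sub_self, pow_zero, Module.End.one_apply,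
          Fin.succAbove_last]
        rw [chain_self L α hα, ← two_mul, pow_mul]
        simp only [even_two, Even.neg_pow, one_pow, one_mul]
        have hsub : ((Matrix.of fun i j : Fin (n + 1 + 1) =>
            (grad ^ (n + 1 - j : ℕ)) (chain L α (n + 1) i) (y j)).submatrix Fin.castSucc
              Fin.castSucc) = Matrix.of fun i j : Fin (n + 1) =>
            (grad ^ (n - j : ℕ)) (chain L α n i) (y j) := by
          ext i j
          simp only [Matrix.submatrix_apply, Matrix.of_apply, Fin.val_castSucc]
          rw [show n + 1 - (j : ℕ) = n - j + 1 by omega, pow_succ, Module.End.mul_apply]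
          refine grad_pow_congr _ fun z hz hz' => grad_chain (by omega) ?_ ?_
          · have := hbound j (by omega)
            omega
          · exact hz'.trans_lt (hlt j)
        rw [hsub, ih]
        refine if_congr ⟨fun h k hk => ?_, fun h k hk => h k (by omega)⟩ rfl rfl
        rcases Nat.lt_or_ge k (n + 1) with h' | h'
        · exact h k (by omega)
        · obtain rfl : k = n + 1 := by omega
          exact hα
      · intro j _ hj
        rw [Matrix.of_apply, hrow j hj]
        simp
      · simp
    · rw [if_neg fun h => hα (h _ le_rfl)]
      refine Matrix.det_eq_zero_of_column_eq_zero (Fin.last (n + 1)) fun i => ?_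
      simp [chain_of_not_le L α _ hα]

/-- The transition function of particle `j`, started from `y j`, that pairs with functions at level
`n`, see `sum_mul_wave`. -/
def wave (p : ℝ) (t n : ℕ) (y : ℕ → ℤ) (j : ℕ) (x : ℤ) : ℂ :=
  (hop p ^ t * grad ^ (n - j)) (Pi.single x 1) (y j)

lemma sum_mul_wave (p : ℝ) {t n : ℕ} {y : ℕ → ℤ} {j : ℕ} {A L : ℤ}
    (hA : A ≤ y j - (n - j : ℕ)) (hL : y j + t < L) (g : ℤ → ℂ) :
    (hop p ^ t * grad ^ (n - j)) g (y j) = ∑ x ∈ Finset.Ico A L, g x * wave p t n y j x := by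
  have h : (hop p ^ t * grad ^ (n - j)) g (y j) = (hop p ^ t * grad ^ (n - j))
      (∑ x ∈ Finset.Ico A L, g x • Pi.single x 1) (y j) := by
    simp only [Module.End.mul_apply]
    refine hop_pow_congr p t fun z h1 h2 => grad_pow_congr _ fun w h3 h4 => ?_
    rw [Finset.sum_apply, Finset.sum_eq_single w]
    · simp
    · intro b _ hb; simp [hb.symm]
    · intro hw; exact absurd (Finset.mem_Ico.2 ⟨by omega, by omega⟩) hw
  rw [h, map_sum, Finset.sum_apply]
  simp [wave]

/-- The joint distribution function of the positions, as the determinant of the pairing of chains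
with transition functions. -/
lemma sum_table_indicator (p : ℝ) (t n : ℕ) (α : ℕ → ℤ) {y : ℕ → ℤ} (hy : StrictAnti y) {A L : ℤ}
    (hA : ∀ j ≤ n, A ≤ y j - (n - j : ℕ)) (hL : y 0 + t < L) :
    ∑ c : Fin t → Fin (n + 1) → Bool, (∏ s, ∏ i, coinWeight p (c s i)) *
      (if ∀ k ≤ n, α k ≤ seqPath y (extendTable c) t k then 1 else 0) =
      (Matrix.of fun i j : Fin (n + 1) =>
        ∑ x ∈ Finset.Ico A L, chain L α n i x * wave p t n y j x).det := by
  have h := sum_table_det p (fun i : Fin (n + 1) => chain L α n i) t y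
  simp only [Nat.add_sub_cancel] at h
  convert h using 1
  · refine Finset.sum_congr rfl fun c _ => ?_
    rw [← det_grad_chain α (strictAnti_seqPath hy (extendTable c) t)
      (lt_of_le_of_lt (seqPath_le _ _ _ _) hL)]
  · congr 1
    ext i j
    simp only [Matrix.of_apply]
    rw [sum_mul_wave p (hA j (by omega))]
    have := hy.antitone (Nat.zero_le (j : ℕ))
    omega

/-! ### Gap probabilities as determinants -/

section LinearAlgebra

variable {N X : Type*} [Fintype N] [DecidableEq N] [Fintype X] [DecidableEq X]

/-- The matrix `1 - M` is unipotent if all nonzero entries of `M` lead to a higher level. -/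
lemma det_one_sub_of_level (lev : X → ℕ) {M : Matrix X X ℂ}
    (h : ∀ a b, ¬ lev a < lev b → M a b = 0) : (1 - M).det = 1 := by
  have hT : (1 - M).BlockTriangular lev := by
    intro i j hij
    rw [Matrix.sub_apply, h i j hij.not_gt, Matrix.one_apply_ne, sub_zero]
    rintro rfl; exact lt_irrefl _ hij
  rw [hT.det]
  refine Finset.prod_eq_one fun a _ => ?_
  have : (1 - M).toSquareBlock lev a = 1 := by
    ext i j
    have : ¬ lev i < lev j := by rw [i.2, j.2]; exact lt_irrefl _
    simp [Matrix.toSquareBlock_def, h _ _ this, Matrix.one_apply, Subtype.ext_iff]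
  rw [this, Matrix.det_one]

lemma det_fromBlocks_zero_one_sub {E G : Matrix N X ℂ} {Ψ : Matrix X N ℂ} {Φ : Matrix X X ℂ}
    (hG : G * (1 - Φ) = E) :
    (Matrix.fromBlocks 0 E (-Ψ) (1 - Φ)).det = (G * Ψ).det * (1 - Φ).det := by
  have h : Matrix.fromBlocks 1 (-G) 0 1 * Matrix.fromBlocks 0 E (-Ψ) (1 - Φ) =
      Matrix.fromBlocks (G * Ψ) 0 (-Ψ) (1 - Φ) := by
    simp [Matrix.fromBlocks_multiply, hG]
  have h2 := congrArg Matrix.det h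
  rwa [Matrix.det_mul, Matrix.det_fromBlocks_zero₂₁, Matrix.det_one, Matrix.det_one, one_mul,
    one_mul, Matrix.det_fromBlocks_zero₁₂] at h2

/-- The determinantal gap formula. The weights are `Φ` (transitions between levels), `E` (entrance
of one new chain at each level) and `Ψ` (exit from the last level); the matrix `D` projects onto
the cut region. The rows of `G₀` and `G` count all chains and the chains that avoid the cut region;
the determinant of the former is normalized to one. If `(B, 1 - K)` agrees, on the rows in the cut
region, with the second block row of the inverse of `((0, E), (-Ψ, 1 - Φ))`, then `1 - D K D` has
the determinant of the chains that avoid the cut region. -/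
lemma det_gap {E G G₀ : Matrix N X ℂ} {Ψ : Matrix X N ℂ} {Φ D K : Matrix X X ℂ}
    {B : Matrix X N ℂ} (hD : D * D = D) (hG : G * (1 - Φ * (1 - D)) = E * (1 - D))
    (hG₀ : G₀ * (1 - Φ) = E) (hΦD : (1 - Φ * (1 - D)).det = 1) (hΦ : (1 - Φ).det = 1)
    (hdet : (G₀ * Ψ).det = 1) (hΨ : D * ((1 - K) * Ψ) = 0)
    (hE : D * (B * E + (1 - K) * (1 - Φ)) = D) :
    (G * Ψ).det = (1 - D * K * D).det := by
  set Z : Matrix (N ⊕ X) (N ⊕ X) ℂ := Matrix.fromBlocks 0 E (-Ψ) (1 - Φ) with hZ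
  set C : Matrix (N ⊕ X) (N ⊕ X) ℂ := Matrix.fromBlocks 0 0 0 D with hC
  set T : Matrix (N ⊕ X) (N ⊕ X) ℂ := Matrix.fromBlocks 1 0 B (1 - K) with hT
  have hZdet : Z.det = 1 := by rw [hZ, det_fromBlocks_zero_one_sub hG₀, hdet, hΦ, one_mul]
  have hCC : C * C = C := by simp [hC, Matrix.fromBlocks_multiply, hD]
  have hCTZ : C * T * Z = C := by
    have e1 : -(D * (1 - K) * Ψ) = 0 := by rw [Matrix.mul_assoc, hΨ, neg_zero]
    have e2 : D * B * E + D * (1 - K) * (1 - Φ) = D := by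
      rw [Matrix.mul_assoc, Matrix.mul_assoc, ← Matrix.mul_add, hE]
    simp only [hC, hT, hZ, Matrix.fromBlocks_multiply]
    simp [e1, e2]
  have hdetT : (1 + C * (T - 1)).det = (1 - D * K * D).det := by
    have : (1 : Matrix (N ⊕ X) (N ⊕ X) ℂ) + C * (T - 1) * C =
        Matrix.fromBlocks 1 0 0 (1 - D * K * D) := by
      rw [hC, hT, ← Matrix.fromBlocks_one (l := N) (m := X), sub_eq_add_neg,
        Matrix.fromBlocks_neg, Matrix.fromBlocks_add, Matrix.fromBlocks_multiply,
        Matrix.fromBlocks_multiply, Matrix.fromBlocks_add]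
      simp [sub_eq_add_neg]
    rw [← hCC, Matrix.mul_assoc, Matrix.det_one_add_mul_comm, this,
      Matrix.det_fromBlocks_zero₂₁, Matrix.det_one, one_mul]
  have hprod : (1 + C * (T - 1)) * Z = 1 + (1 - C) * (Z - 1) := by
    rw [Matrix.mul_sub, Matrix.mul_one, Matrix.add_mul, Matrix.sub_mul, hCTZ]
    noncomm_ring
  have hcut : 1 + (Z - 1) * (1 - C) =
      Matrix.fromBlocks 0 (E * (1 - D)) (-Ψ) (1 - Φ * (1 - D)) := by
    rw [hC, hZ, ← Matrix.fromBlocks_one (l := N) (m := X)]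
    simp only [sub_eq_add_neg, Matrix.fromBlocks_neg, Matrix.fromBlocks_add,
      Matrix.fromBlocks_multiply]
    congr 1
    · simp
    · simp
    · simp
    · simp only [neg_zero, add_zero, Matrix.mul_zero, zero_add]
      noncomm_ring
  calc (G * Ψ).det = (Matrix.fromBlocks 0 (E * (1 - D)) (-Ψ) (1 - Φ * (1 - D))).det := by
        rw [det_fromBlocks_zero_one_sub hG, hΦD, mul_one]
    _ = ((1 + C * (T - 1)) * Z).det := by
        rw [← hcut, hprod, Matrix.det_one_add_mul_comm]
    _ = _ := by rw [Matrix.det_mul, hZdet, mul_one, hdetT]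

/-- Uniqueness of the rows of the inverse of the block matrix `((0, E), (-Ψ, 1 - Φ))`. -/
lemma row_eq_zero {E G₀ : Matrix N X ℂ} {Ψ : Matrix X N ℂ} {Φ : Matrix X X ℂ}
    (hG₀ : G₀ * (1 - Φ) = E) (hΦ : (1 - Φ).det = 1) (hdet : (G₀ * Ψ).det = 1) {b : N → ℂ}
    {k : X → ℂ} (hΨ : Matrix.vecMul k Ψ = 0)
    (hE : Matrix.vecMul k (1 - Φ) = Matrix.vecMul b E) : k = 0 := by
  have h1 : k = Matrix.vecMul b G₀ := by
    rw [← sub_eq_zero]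
    refine Matrix.eq_zero_of_vecMul_eq_zero (M := 1 - Φ) (by rw [hΦ]; exact one_ne_zero) ?_
    rw [Matrix.sub_vecMul, Matrix.vecMul_vecMul, hG₀, hE, sub_self]
  have h2 : b = 0 := by
    refine Matrix.eq_zero_of_vecMul_eq_zero (M := G₀ * Ψ) (by rw [hdet]; exact one_ne_zero) ?_
    rw [← Matrix.vecMul_vecMul, ← h1, hΨ]
  rw [h1, h2, Matrix.zero_vecMul]

end LinearAlgebra

/-! ### Contour integrals of rational functions -/

section Contour

variable {p : ℝ} {γ : ℝ → ℂ}

/-- The integrand of `contourIntegral γ f` is integrable. -/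
def LoopIntegrable (γ : ℝ → ℂ) (f : ℂ → ℂ) : Prop :=
  IntervalIntegrable (fun s => f (γ s) * deriv γ s) volume 0 1

lemma LoopIntegrable.add {f g : ℂ → ℂ} (hf : LoopIntegrable γ f) (hg : LoopIntegrable γ g) :
    LoopIntegrable γ fun v => f v + g v := by
  simpa only [LoopIntegrable, add_mul] using IntervalIntegrable.add hf hg

lemma LoopIntegrable.const_mul {f : ℂ → ℂ} (hf : LoopIntegrable γ f) (c : ℂ) :
    LoopIntegrable γ fun v => c * f v := by
  simpa only [LoopIntegrable, mul_assoc] using IntervalIntegrable.const_mul hf c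

lemma LoopIntegrable.sum {ι : Type*} (s : Finset ι) {f : ι → ℂ → ℂ}
    (hf : ∀ i ∈ s, LoopIntegrable γ (f i)) : LoopIntegrable γ fun v => ∑ i ∈ s, f i v := by
  simp only [LoopIntegrable, Finset.sum_mul]
  simpa only [Finset.sum_fn] using IntervalIntegrable.sum s hf

lemma contourIntegral_add {f g : ℂ → ℂ} (hf : LoopIntegrable γ f) (hg : LoopIntegrable γ g) :
    contourIntegral γ (fun v => f v + g v) = contourIntegral γ f + contourIntegral γ g := by
  simp only [contourIntegral, add_mul]
  rw [intervalIntegral.integral_add hf hg, mul_add]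

lemma contourIntegral_const_mul (f : ℂ → ℂ) (c : ℂ) :
    contourIntegral γ (fun v => c * f v) = c * contourIntegral γ f := by
  simp only [contourIntegral, mul_assoc]
  rw [intervalIntegral.integral_const_mul]
  ring

lemma contourIntegral_sum {ι : Type*} (s : Finset ι) {f : ι → ℂ → ℂ}
    (hf : ∀ i ∈ s, LoopIntegrable γ (f i)) :
    contourIntegral γ (fun v => ∑ i ∈ s, f i v) = ∑ i ∈ s, contourIntegral γ (f i) := by
  simp only [contourIntegral, Finset.sum_mul]
  rw [intervalIntegral.integral_finsetSum hf, Finset.mul_sum]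

/-- The points of a loop, as a set. -/
abbrev trace (γ : ℝ → ℂ) : Set ℂ := γ '' Icc 0 1

/-- A simple loop meets a finite set at finitely many times only. -/
lemma ae_notMem_of_finite (hγ : IsSimpleLoop γ) {S : Set ℂ} (hS : S.Finite) :
    ∀ᵐ s : ℝ, s ∈ Icc (0 : ℝ) 1 → γ s ∉ S := by
  have hfin : (Ico 0 1 ∩ γ ⁻¹' S).Finite := by
    refine Set.Finite.of_finite_image (hS.subset ?_) (hγ.injOn.mono inter_subset_left)
    rintro _ ⟨s, hs, rfl⟩; exact hs.2
  have h : ∀ᵐ s : ℝ, s ∉ (Ico 0 1 ∩ γ ⁻¹' S) ∪ {1} :=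
    (hfin.union (finite_singleton 1)).countable.ae_notMem volume
  filter_upwards [h] with s hs hs1 hS
  apply hs
  rcases eq_or_lt_of_le hs1.2 with h | h
  · exact Or.inr h
  · exact Or.inl ⟨⟨hs1.1, h⟩, hS⟩

/-- Contour integrals do not see finitely many points of the loop. -/
lemma ae_integrand_eq (hγ : IsSimpleLoop γ) {S : Set ℂ} (hS : S.Finite) {f g : ℂ → ℂ}
    (h : ∀ v ∈ trace γ, v ∉ S → f v = g v) :
    ∀ᵐ s : ℝ, s ∈ Set.uIoc (0 : ℝ) 1 → f (γ s) * deriv γ s = g (γ s) * deriv γ s := by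
  filter_upwards [ae_notMem_of_finite hγ hS] with s hs hs1
  rw [Set.uIoc_of_le zero_le_one] at hs1
  rw [h _ ⟨s, ⟨hs1.1.le, hs1.2⟩, rfl⟩ (hs ⟨hs1.1.le, hs1.2⟩)]

lemma contourIntegral_congr (hγ : IsSimpleLoop γ) {S : Set ℂ} (hS : S.Finite) {f g : ℂ → ℂ}
    (h : ∀ v ∈ trace γ, v ∉ S → f v = g v) : contourIntegral γ f = contourIntegral γ g := by
  simp only [contourIntegral]
  rw [intervalIntegral.integral_congr_ae (ae_integrand_eq hγ hS h)]

lemma LoopIntegrable.congr (hγ : IsSimpleLoop γ) {S : Set ℂ} (hS : S.Finite) {f g : ℂ → ℂ}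
    (h : ∀ v ∈ trace γ, v ∉ S → f v = g v) (hg : LoopIntegrable γ g) : LoopIntegrable γ f := by
  refine IntervalIntegrable.congr_ae hg ?_
  rw [Filter.EventuallyEq, ae_restrict_iff' measurableSet_uIoc]
  filter_upwards [ae_integrand_eq hγ hS h] with s hs h1 using (hs h1).symm

lemma loopIntegrable_of_continuousOn (hγ : IsSimpleLoop γ) {f : ℂ → ℂ}
    (hf : ContinuousOn f (trace γ)) : LoopIntegrable γ f := by
  refine hγ.integrable.continuousOn_mul ?_
  rw [Set.uIcc_of_le zero_le_one]
  exact hf.comp hγ.continuousOn (mapsTo_image γ _)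

/-- A function with a primitive has integral zero over a closed curve. -/
lemma contourIntegral_eq_zero_of_hasDerivAt (hγ : IsSimpleLoop γ) {F f : ℂ → ℂ}
    (hF : ∀ v ∈ trace γ, HasDerivAt F (f v) v) (hf : ContinuousOn f (trace γ)) :
    contourIntegral γ f = 0 := by
  obtain ⟨S, hS, hd⟩ := hγ.piecewise
  have h := integral_eq_of_hasDerivAt_off_countable_of_le (fun s => F (γ s))
    (fun s => f (γ s) * deriv γ s) zero_le_one hS.countable ?_ ?_
    (loopIntegrable_of_continuousOn hγ hf)
  · rw [contourIntegral, h, hγ.closed, sub_self, mul_zero]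
  · have hFc : ContinuousOn F (trace γ) := fun v hv => (hF v hv).continuousAt.continuousWithinAt
    exact hFc.comp hγ.continuousOn (mapsTo_image γ _)
  · intro s hs
    have h1 := HasDerivAt.scomp s (hF _ ⟨s, Ioo_subset_Icc_self hs.1, rfl⟩) (hd s hs).1.hasDerivAt
    rw [smul_eq_mul, mul_comm] at h1
    exact h1

lemma contourIntegral_zpow (hγ : IsSimpleLoop γ) {w : ℂ} (hw : w ∉ trace γ) {n : ℤ} (hn : n ≠ -1) :
    contourIntegral γ (fun v => (v - w) ^ n) = 0 := by
  have hne : ∀ v ∈ trace γ, v - w ≠ 0 := fun v hv h => hw (by rwa [← sub_eq_zero.1 h])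
  have hn' : (n : ℂ) + 1 ≠ 0 := by
    intro h; apply hn
    have : ((n + 1 : ℤ) : ℂ) = 0 := by push_cast; exact h
    have := Int.cast_eq_zero.1 this
    omega
  refine contourIntegral_eq_zero_of_hasDerivAt hγ
    (F := fun v => (v - w) ^ (n + 1) / (n + 1)) (fun v hv => ?_) (fun v hv => ?_)
  · have h1 := (hasDerivAt_zpow (n + 1) (v - w) (Or.inl (hne v hv))).comp v
      ((hasDerivAt_id v).sub_const w)
    have h2 := h1.div_const ((n : ℂ) + 1)
    simp only [add_sub_cancel_right, mul_one] at h2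
    push_cast at h2
    rwa [mul_div_cancel_left₀ _ hn'] at h2
  · exact ((continuousAt_id.sub continuousAt_const).zpow₀ n
      (Or.inl (hne v hv))).continuousWithinAt

namespace IsLoopAroundZero

lemma ne_zero (hγ : IsLoopAroundZero p γ) {v : ℂ} (hv : v ∈ trace γ) : v ≠ 0 := by
  obtain ⟨s, hs, rfl⟩ := hv; exact (hγ.avoids s hs).1

lemma one_add_ne_zero (hγ : IsLoopAroundZero p γ) {v : ℂ} (hv : v ∈ trace γ) : 1 + v ≠ 0 := by
  obtain ⟨s, hs, rfl⟩ := hv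
  intro h; exact (hγ.avoids s hs).2.1 (by linear_combination h)

lemma one_add_mul_ne_zero (hp : p ≠ 0) (hγ : IsLoopAroundZero p γ) {v : ℂ} (hv : v ∈ trace γ) :
    1 + p * v ≠ 0 := by
  obtain ⟨s, hs, rfl⟩ := hv
  intro h; apply (hγ.avoids s hs).2.2
  have : (p : ℂ) ≠ 0 := by exact_mod_cast hp
  field_simp
  linear_combination h

lemma continuousOn_zpow (hp : p ≠ 0) (hγ : IsLoopAroundZero p γ) (a b c : ℤ) :
    ContinuousOn (fun v : ℂ => v ^ a * (1 + v) ^ b * (1 + p * v) ^ c) (trace γ) := by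
  intro v hv
  have h1 : ContinuousAt (fun v : ℂ => v ^ a) v :=
    continuousAt_id.zpow₀ a (Or.inl (hγ.ne_zero hv))
  have h2 : ContinuousAt (fun v : ℂ => (1 + v) ^ b) v :=
    (continuousAt_const.add continuousAt_id).zpow₀ b (Or.inl (hγ.one_add_ne_zero hv))
  have h3 : ContinuousAt (fun v : ℂ => (1 + p * v) ^ c) v :=
    (continuousAt_const.add (continuousAt_const.mul continuousAt_id)).zpow₀ c
      (Or.inl (hγ.one_add_mul_ne_zero hp hv))
  exact ((h1.mul h2).mul h3).continuousWithinAt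

lemma loopIntegrable_zpow (hp : p ≠ 0) (hγ : IsLoopAroundZero p γ) (a b c : ℤ) :
    LoopIntegrable γ fun v : ℂ => v ^ a * (1 + v) ^ b * (1 + p * v) ^ c :=
  loopIntegrable_of_continuousOn hγ.simple (hγ.continuousOn_zpow hp a b c)

lemma contourIntegral_one_add_zpow (hγ : IsLoopAroundZero p γ) (b : ℤ) :
    contourIntegral γ (fun v => (1 + v) ^ b) = 0 := by
  have e : (fun v : ℂ => (1 + v) ^ b) = fun v => (v - (-1)) ^ b := by
    ext v; congr 1; ring
  rw [e]
  by_cases hb : b = -1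
  · subst hb
    have := hγ.winding_neg_one
    simp only [winding] at this
    simpa using this
  · refine contourIntegral_zpow hγ.simple (fun h => ?_) hb
    exact hγ.one_add_ne_zero h (by ring)

lemma contourIntegral_one_add_mul_zpow (hp : p ≠ 0) (hγ : IsLoopAroundZero p γ) (c : ℤ) :
    contourIntegral γ (fun v => (1 + p * v) ^ c) = 0 := by
  have hp' : (p : ℂ) ≠ 0 := by exact_mod_cast hp
  have e : (fun v : ℂ => (1 + p * v) ^ c) = fun v => (p : ℂ) ^ c * (v - (-1 / p)) ^ c := by
    ext v; rw [← mul_zpow]; congr 1; field_simp; ring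
  rw [e, contourIntegral_const_mul]
  by_cases hb : c = -1
  · subst hb
    have := hγ.winding_neg_inv
    simp only [winding] at this
    simp only [zpow_neg_one, this, mul_zero]
  · rw [contourIntegral_zpow hγ.simple (fun h => ?_) hb, mul_zero]
    exact hγ.one_add_mul_ne_zero hp h (by field_simp; ring)

/-- Products of powers of `1 + v` and of `1 + p v` have no residue inside the loop. The relation
`1 + p v = p (1 + v) + (1 - p)` reduces the claim to powers of one factor. -/
lemma contourIntegral_outer (hp0 : p ≠ 0) (hp1 : p ≠ 1) (hγ : IsLoopAroundZero p γ) (b : ℤ)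
    (t : ℕ) : contourIntegral γ (fun v => (1 + v) ^ b * (1 + p * v) ^ (-(t : ℤ))) = 0 := by
  have hp' : (p : ℂ) ≠ 0 := by exact_mod_cast hp0
  have hp1' : (1 - p : ℂ) ≠ 0 := by
    rw [sub_ne_zero]; exact_mod_cast hp1.symm
  have hint : ∀ b c : ℤ, LoopIntegrable γ fun v : ℂ => (1 + v) ^ b * (1 + p * v) ^ c := by
    intro b c; simpa using hγ.loopIntegrable_zpow hp0 0 b c
  induction t generalizing b with
  | zero => simpa using hγ.contourIntegral_one_add_zpow b
  | succ t ih =>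
    set q : ℤ → ℂ := fun b =>
      contourIntegral γ (fun v => (1 + v) ^ b * (1 + p * v) ^ (-((t + 1 : ℕ) : ℤ))) with hq
    have hrec : ∀ b, p * q (b + 1) + (1 - p) * q b = 0 := by
      intro b
      rw [hq]
      simp only
      rw [← contourIntegral_const_mul, ← contourIntegral_const_mul,
        ← contourIntegral_add ((hint _ _).const_mul _) ((hint _ _).const_mul _), ← ih b]
      refine contourIntegral_congr hγ.simple finite_empty fun v hv _ => ?_
      have e : (-(t : ℤ)) = -((t + 1 : ℕ) : ℤ) + 1 := by push_cast; ring
      rw [e, zpow_add_one₀ (hγ.one_add_mul_ne_zero hp0 hv), zpow_add_one₀ (hγ.one_add_ne_zero hv)]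
      ring
    have h0 : q 0 = 0 := by
      simp only [hq, zpow_zero, one_mul]
      exact hγ.contourIntegral_one_add_mul_zpow hp0 _
    change q b = 0
    induction b with
    | zero => exact h0
    | succ i hi =>
      have := hrec i
      rw [hi, mul_zero, add_zero] at this
      exact (mul_eq_zero.1 this).resolve_left hp'
    | pred i hi =>
      have := hrec (-i - 1)
      rw [sub_add_cancel, hi, mul_zero, zero_add] at this
      exact (mul_eq_zero.1 this).resolve_left hp1'

/-- A function without a pole inside the loop has integral zero. -/
lemma contourIntegral_eval_mul (hp0 : p ≠ 0) (hp1 : p ≠ 1) (hγ : IsLoopAroundZero p γ)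
    (P : ℂ[X]) (b : ℤ) (t : ℕ) :
    contourIntegral γ (fun v => P.eval v * ((1 + v) ^ b * (1 + p * v) ^ (-(t : ℤ)))) = 0 := by
  have hint : ∀ b c : ℤ, LoopIntegrable γ fun v : ℂ => (1 + v) ^ b * (1 + p * v) ^ c := by
    intro b c; simpa using hγ.loopIntegrable_zpow hp0 0 b c
  set R := P.comp (X - 1) with hR
  have e : ∀ v ∈ trace γ, v ∉ (∅ : Set ℂ) →
      P.eval v * ((1 + v) ^ b * (1 + p * v) ^ (-(t : ℤ))) =
      ∑ i ∈ Finset.range (R.natDegree + 1),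
        R.coeff i * ((1 + v) ^ (b + i) * (1 + p * v) ^ (-(t : ℤ))) := by
    intro v hv _
    have : P.eval v = R.eval (1 + v) := by simp [hR]
    rw [this, eval_eq_sum_range, Finset.sum_mul]
    refine Finset.sum_congr rfl fun i _ => ?_
    rw [zpow_add₀ (hγ.one_add_ne_zero hv), zpow_natCast]
    ring
  rw [contourIntegral_congr hγ.simple finite_empty e,
    contourIntegral_sum _ fun i _ => (hint _ _).const_mul _]
  refine Finset.sum_eq_zero fun i _ => ?_
  rw [contourIntegral_const_mul, hγ.contourIntegral_outer hp0 hp1, mul_zero]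

lemma contourIntegral_zpow_mul_succ (hp : p ≠ 0) (hγ : IsLoopAroundZero p γ) (a b : ℤ) :
    contourIntegral γ (fun v => v ^ a * (1 + v) ^ (b + 1)) =
      contourIntegral γ (fun v => v ^ a * (1 + v) ^ b) +
        contourIntegral γ (fun v => v ^ (a + 1) * (1 + v) ^ b) := by
  have hint : ∀ a b : ℤ, LoopIntegrable γ fun v : ℂ => v ^ a * (1 + v) ^ b := by
    intro a b; simpa using hγ.loopIntegrable_zpow hp a b 0
  rw [← contourIntegral_add (hint _ _) (hint _ _)]
  refine contourIntegral_congr hγ.simple finite_empty fun v hv _ => ?_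
  rw [zpow_add_one₀ (hγ.one_add_ne_zero hv), zpow_add_one₀ (hγ.ne_zero hv)]
  ring

lemma contourIntegral_pow_mul (hp : p ≠ 0) (hγ : IsLoopAroundZero p γ) {a : ℤ} (ha : 0 ≤ a)
    (b : ℤ) : contourIntegral γ (fun v => v ^ a * (1 + v) ^ b) = 0 := by
  obtain ⟨a, rfl⟩ := Int.eq_ofNat_of_zero_le ha
  induction a generalizing b with
  | zero => simpa using hγ.contourIntegral_one_add_zpow b
  | succ a ih =>
    have h := hγ.contourIntegral_zpow_mul_succ hp a b
    rw [ih b (by omega), ih (b + 1) (by omega), zero_add] at h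
    push_cast
    exact h.symm

/-- The residue of `v ^ (-k - 1) * (1 + v) ^ b` at the origin. -/
lemma contourIntegral_residue (hp : p ≠ 0) (hγ : IsLoopAroundZero p γ) (k : ℕ) (b : ℤ) :
    contourIntegral γ (fun v => v ^ (-(k : ℤ) - 1) * (1 + v) ^ b) = (Ring.choose b k : ℤ) := by
  have hbase : ∀ k : ℕ, contourIntegral γ (fun v => v ^ (-(k : ℤ) - 1) * (1 + v) ^ (0 : ℤ)) =
      (Ring.choose (0 : ℤ) k : ℤ) := by
    intro k
    simp only [zpow_zero, mul_one]
    cases k with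
    | zero =>
      have := hγ.winding_zero
      simp only [winding, sub_zero] at this
      simpa using this
    | succ k =>
      have := contourIntegral_zpow hγ.simple (w := 0) (fun h => hγ.ne_zero h rfl)
        (n := -((k + 1 : ℕ) : ℤ) - 1) (by push_cast; omega)
      simp only [sub_zero] at this
      rw [this, Ring.choose_zero_succ, Int.cast_zero]
  have hstep : ∀ (k : ℕ) (b : ℤ), (∀ b : ℤ,
      contourIntegral γ (fun v => v ^ (-(k : ℤ) - 1 + 1) * (1 + v) ^ b) =
        (Ring.choose (b + 1) k - Ring.choose b k : ℤ)) →
      contourIntegral γ (fun v => v ^ (-(k : ℤ) - 1) * (1 + v) ^ b) =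
        ((Ring.choose (b : ℤ) k : ℤ) : ℂ) := by
    intro k b hk
    induction b with
    | zero => exact hbase k
    | succ i hi =>
      rw [hγ.contourIntegral_zpow_mul_succ hp, hi, hk]
      push_cast; ring
    | pred i hi =>
      have h := hγ.contourIntegral_zpow_mul_succ hp (-(k : ℤ) - 1) (-i - 1)
      rw [sub_add_cancel, hi, hk, sub_add_cancel] at h
      push_cast at h ⊢
      linear_combination -h
  induction k generalizing b with
  | zero =>
    refine hstep 0 b fun b => ?_
    rw [hγ.contourIntegral_pow_mul hp (by simp)]
    simp
  | succ k ih =>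
    refine hstep (k + 1) b fun b => ?_
    have e : -((k + 1 : ℕ) : ℤ) - 1 + 1 = -(k : ℤ) - 1 := by push_cast; ring
    rw [Ring.choose_succ_succ, add_sub_cancel_right, e, ih b]

end IsLoopAroundZero

end Contour

/-! ### Sums over the nontrivial roots -/

/-- The function `V` on the `v`-plane (with the sign that makes it positive on `(-1, 0)`), whose
fibres are the sets of roots `u₀(v), …, u_{d-1}(v)`. -/
def cover (d : ℕ) (v : ℂ) : ℂ := -v * (1 + v) ^ (d - 1)

/-- The sum of `(-u) ^ a * (1 + u) ^ b / (1 + d * u)` over the nontrivial roots `u`. -/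
def rootSum (d : ℕ) (a b : ℤ) (v : ℂ) : ℂ :=
  ((nontrivialRoots d v).map fun u : ℂ => (-u) ^ a * (1 + u) ^ b / (1 + d * u)).sum

/-- The polynomial whose roots are the points in the fibre of `cover d` over `-c`. -/
def fibrePoly (d : ℕ) (c : ℂ) : ℂ[X] := X * (1 + X) ^ (d - 1) - C c

/-- The points whose fibre is unramified and contains neither `0` nor `-1`. The ramification points
of `cover d` are `-1` (if `d > 2`) and `-1 / d`. -/
def IsGeneric (d : ℕ) (v : ℂ) : Prop :=
  v ≠ 0 ∧ 1 + v ≠ 0 ∧ cover d v ≠ cover d (-1 / d)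

lemma fibrePoly_monic (d : ℕ) (c : ℂ) : (fibrePoly d c).Monic := by
  have h1 : (X * (1 + X) ^ (d - 1) : ℂ[X]).Monic := by
    have : (1 + X : ℂ[X]).Monic := by simpa [add_comm] using monic_X_add_C (1 : ℂ)
    exact monic_X.mul (this.pow _)
  refine h1.sub_of_left ?_
  refine lt_of_le_of_lt degree_C_le ?_
  rw [← natDegree_pos_iff_degree_pos]
  have : (X * (1 + X) ^ (d - 1) : ℂ[X]).natDegree = 1 + (d - 1) := by
    have h2 : (1 + X : ℂ[X]).Monic := by simpa [add_comm] using monic_X_add_C (1 : ℂ)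
    have h3 : (1 + X : ℂ[X]).natDegree = 1 := by
      simpa [add_comm] using natDegree_X_add_C (1 : ℂ)
    rw [monic_X.natDegree_mul (h2.pow _), natDegree_X, h2.natDegree_pow, h3, mul_one]
  omega

lemma fibrePoly_natDegree {d : ℕ} (hd : 2 ≤ d) (c : ℂ) : (fibrePoly d c).natDegree = d := by
  have h2 : (1 + X : ℂ[X]).Monic := by simpa [add_comm] using monic_X_add_C (1 : ℂ)
  have h3 : (1 + X : ℂ[X]).natDegree = 1 := by
    simpa [add_comm] using natDegree_X_add_C (1 : ℂ)
  rw [fibrePoly, natDegree_sub_C, monic_X.natDegree_mul (h2.pow _), natDegree_X, h2.natDegree_pow,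
    h3, mul_one]
  omega

lemma mem_roots_fibrePoly {d : ℕ} {c u : ℂ} :
    u ∈ (fibrePoly d c).roots ↔ u * (1 + u) ^ (d - 1) = c := by
  rw [mem_roots (fibrePoly_monic d c).ne_zero]
  simp [fibrePoly, sub_eq_zero]

lemma finite_not_isGeneric (d : ℕ) : {v : ℂ | ¬ IsGeneric d v}.Finite := by
  refine (((fibrePoly d (-cover d (-1 / d))).roots.toFinset.finite_toSet.union
    (Set.toFinite {0, -1})).subset ?_)
  intro v hv
  simp only [IsGeneric, mem_ofPred_eq, not_and_or, not_not] at hv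
  simp only [mem_union, Finset.mem_coe, Multiset.mem_toFinset, mem_roots_fibrePoly,
    Set.mem_insert_iff, Set.mem_singleton_iff]
  rcases hv with h | h | h
  · exact Or.inr (Or.inl h)
  · exact Or.inr (Or.inr (by linear_combination h))
  · left; rw [← h, cover]; ring

lemma mem_roots_self (d : ℕ) (v : ℂ) :
    v ∈ (fibrePoly d (v * (1 + v) ^ (d - 1))).roots := mem_roots_fibrePoly.2 rfl

lemma cover_eq_of_mem {d : ℕ} {u v : ℂ}
    (hu : u ∈ (fibrePoly d (v * (1 + v) ^ (d - 1))).roots) : cover d u = cover d v := by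
  rw [cover, cover, neg_mul, mem_roots_fibrePoly.1 hu, neg_mul]

lemma IsGeneric.of_mem {d : ℕ} (hd : 2 ≤ d) {u v : ℂ} (hv : IsGeneric d v)
    (hu : u ∈ (fibrePoly d (v * (1 + v) ^ (d - 1))).roots) : IsGeneric d u := by
  have h := cover_eq_of_mem hu
  have hne : cover d v ≠ 0 := mul_ne_zero (neg_ne_zero.2 hv.1) (pow_ne_zero _ hv.2.1)
  refine ⟨?_, ?_, h ▸ hv.2.2⟩
  · rintro rfl
    exact hne (by rw [← h, cover]; ring)
  · intro h0
    apply hne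
    rw [← h, cover, h0, zero_pow (by omega), mul_zero]

lemma IsGeneric.one_add_mul_ne_zero {d : ℕ} (hd : 2 ≤ d) {v : ℂ} (hv : IsGeneric d v) :
    1 + d * v ≠ 0 := by
  intro h
  apply hv.2.2
  have : (d : ℂ) ≠ 0 := by exact_mod_cast (by omega : d ≠ 0)
  congr 1
  field_simp
  linear_combination h

lemma IsGeneric.cover_ne_zero {d : ℕ} {v : ℂ} (hv : IsGeneric d v) : cover d v ≠ 0 :=
  mul_ne_zero (neg_ne_zero.2 hv.1) (pow_ne_zero _ hv.2.1)

lemma eval_derivative_fibrePoly {d : ℕ} (hd : 2 ≤ d) (c u : ℂ) :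
    (derivative (fibrePoly d c)).eval u = (1 + u) ^ (d - 2) * (1 + d * u) := by
  obtain ⟨e, rfl⟩ := Nat.exists_eq_add_of_le' hd
  simp [fibrePoly, derivative_mul, derivative_pow]
  ring

lemma nodup_roots_fibrePoly {d : ℕ} (hd : 2 ≤ d) {v : ℂ} (hv : IsGeneric d v) :
    (fibrePoly d (v * (1 + v) ^ (d - 1))).roots.Nodup := by
  refine Multiset.nodup_iff_count_le_one.2 fun u => ?_
  rw [count_roots]
  by_contra h
  rw [not_le, one_lt_rootMultiplicity_iff_isRoot (fibrePoly_monic d _).ne_zero] at h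
  have hu := hv.of_mem hd ((mem_roots (fibrePoly_monic d _).ne_zero).2 h.1)
  have h2 := h.2
  rw [IsRoot.def, eval_derivative_fibrePoly hd] at h2
  exact mul_ne_zero (pow_ne_zero _ hu.2.1) (hu.one_add_mul_ne_zero hd) h2

/-- Lagrange interpolation on a fibre: the sum of `P(u)` divided by the derivative of the fibre
polynomial is the coefficient of `P` of degree `d - 1`. -/
lemma sum_fibre_div {d : ℕ} (hd : 2 ≤ d) {v : ℂ} (hv : IsGeneric d v) {P : ℂ[X]}
    (hP : P.degree < d) :
    ((fibrePoly d (v * (1 + v) ^ (d - 1))).roots.map fun u =>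
      P.eval u / ((1 + u) ^ (d - 2) * (1 + d * u))).sum = P.coeff (d - 1) := by
  set R := fibrePoly d (v * (1 + v) ^ (d - 1)) with hR
  have hspl : R.Splits := IsAlgClosed.splits R
  let Z : Finset ℂ := ⟨R.roots, nodup_roots_fibrePoly hd hv⟩
  have hcard : Z.card = d := by
    change R.roots.card = d
    rw [← hspl.natDegree_eq_card_roots, fibrePoly_natDegree hd]
  have h := Lagrange.coeff_eq_sum (s := Z) (v := id) Function.injective_id.injOn (P := P)
    (by rw [hcard]; exact hP)
  rw [hcard] at h
  rw [h]
  change ∑ u ∈ Z, _ = _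
  refine Finset.sum_congr rfl fun u hu => ?_
  congr 1
  rw [← eval_derivative_fibrePoly hd (v * (1 + v) ^ (d - 1)),
    hspl.eval_root_derivative (fibrePoly_monic d _) hu]
  rfl

/-- The sum over a whole fibre, including the trivial root. -/
def fibreSum (d : ℕ) (k : ℕ) (v : ℂ) : ℂ :=
  ((fibrePoly d (v * (1 + v) ^ (d - 1))).roots.map fun u : ℂ => (1 + u) ^ k / (1 + d * u)).sum

lemma degree_one_add_X_pow (k : ℕ) : ((1 + X : ℂ[X]) ^ k).degree = k := by
  have h2 : (1 + X : ℂ[X]).Monic := by simpa [add_comm] using monic_X_add_C (1 : ℂ)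
  have h3 : (1 + X : ℂ[X]).degree = 1 := by
    simpa [add_comm] using degree_X_add_C (1 : ℂ)
  rw [degree_pow, h3]; simp

/-- The relation `w ^ d = w ^ (d - 1) - V` on the fibre, for `w = 1 + u`. -/
lemma one_add_pow_of_mem {d : ℕ} (hd : 2 ≤ d) {u v : ℂ}
    (hu : u ∈ (fibrePoly d (v * (1 + v) ^ (d - 1))).roots) (m : ℕ) :
    (1 + u) ^ (m + d) = (1 + u) ^ (m + d - 1) - cover d v * (1 + u) ^ m := by
  rw [← cover_eq_of_mem hu, cover]
  obtain ⟨e, rfl⟩ := Nat.exists_eq_add_of_le' hd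
  rw [show m + (e + 2) - 1 = m + (e + 1) by omega, show e + 2 - 1 = e + 1 by omega]
  ring

lemma fibreSum_eq {d : ℕ} (hd : 2 ≤ d) {v : ℂ} (hv : IsGeneric d v) {k : ℕ} (hk : k < d) :
    fibreSum d k v = if k = 0 then 0 else 1 := by
  have hconv : ∀ k : ℕ, fibreSum d k v = ((fibrePoly d (v * (1 + v) ^ (d - 1))).roots.map fun u =>
      ((1 + X : ℂ[X]) ^ (k + d - 2)).eval u / ((1 + u) ^ (d - 2) * (1 + d * u))).sum := by
    intro k
    rw [fibreSum]
    congr 1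
    refine Multiset.map_congr rfl fun u hu => ?_
    have h1 := (hv.of_mem hd hu).2.1
    have h2 := (hv.of_mem hd hu).one_add_mul_ne_zero hd
    rw [show k + d - 2 = k + (d - 2) by omega]
    simp only [pow_add, eval_mul, eval_pow, eval_add, eval_one, eval_X]
    field_simp
  have h0 : fibreSum d 0 v = 0 := by
    rw [hconv, sum_fibre_div hd hv]
    · refine coeff_eq_zero_of_degree_lt ?_
      rw [degree_one_add_X_pow]; exact_mod_cast (by omega : 0 + d - 2 < d - 1)
    · rw [degree_one_add_X_pow]; exact_mod_cast (by omega : 0 + d - 2 < d)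
  have h1 : fibreSum d 1 v = 1 := by
    rw [hconv, sum_fibre_div hd hv, show 1 + d - 2 = d - 1 by omega, add_comm]
    · have := coeff_X_add_one_pow ℂ (d - 1) (d - 1)
      simpa using this
    · rw [degree_one_add_X_pow]; exact_mod_cast (by omega : 1 + d - 2 < d)
  have hstep : ∀ k, 1 ≤ k → k < d → fibreSum d k v = 1 := by
    intro k hk1
    induction k, hk1 using Nat.le_induction with
    | base => exact fun _ => h1
    | succ k hk1 ih =>
      intro hkd
      have hz : ((fibrePoly d (v * (1 + v) ^ (d - 1))).roots.map fun u =>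
          ((1 + X : ℂ[X]) ^ (k - 1)).eval u / ((1 + u) ^ (d - 2) * (1 + d * u))).sum = 0 := by
        rw [sum_fibre_div hd hv]
        · refine coeff_eq_zero_of_degree_lt ?_
          rw [degree_one_add_X_pow]; exact_mod_cast (by omega : k - 1 < d - 1)
        · rw [degree_one_add_X_pow]; exact_mod_cast (by omega : k - 1 < d)
      have hk := ih (by omega)
      rw [hconv] at hk
      have e : fibreSum d (k + 1) v = 1 - cover d v * 0 := by
        rw [← hk, ← hz, hconv, ← Multiset.sum_map_mul_left, ← Multiset.sum_map_sub]
        congr 1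
        refine Multiset.map_congr rfl fun u hu => ?_
        have := one_add_pow_of_mem hd hu (k - 1)
        simp only [eval_pow, eval_add, eval_one, eval_X]
        rw [show k + 1 + d - 2 = k - 1 + d by omega, show k + d - 2 = k - 1 + d - 1 by omega, this]
        ring
      rw [e, mul_zero, sub_zero]
  split_ifs with h
  · rw [h]; exact h0
  · exact hstep k (by omega) hk

lemma rootSum_eq_fibreSum (d k : ℕ) (v : ℂ) :
    rootSum d 0 k v = fibreSum d k v - (1 + v) ^ k / (1 + d * v) := by
  have h := Multiset.sum_map_erase (f := fun u : ℂ => (1 + u) ^ k / (1 + d * u))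
    (mem_roots_self d v)
  rw [fibreSum, ← h, rootSum]
  simp only [zpow_zero, one_mul, zpow_natCast, add_sub_cancel_left]
  rfl

/-- The sums over the roots in the first segment of the staircase, where Lagrange interpolation
gives the sum over the whole fibre. -/
lemma rootSum_base {d : ℕ} (hd : 2 ≤ d) {v : ℂ} (hv : IsGeneric d v) {k : ℕ} (hk : k < d) :
    (1 + d * v) * rootSum d 0 k v = (if k = 0 then 0 else 1 + d * v) - (1 + v) ^ k := by
  have := hv.one_add_mul_ne_zero hd
  rw [rootSum_eq_fibreSum, fibreSum_eq hd hv hk]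
  split_ifs
  · field_simp; ring
  · field_simp

lemma isGeneric_of_mem_nontrivialRoots {d : ℕ} (hd : 2 ≤ d) {u v : ℂ} (hv : IsGeneric d v)
    (hu : u ∈ nontrivialRoots d v) : IsGeneric d u :=
  hv.of_mem hd (Multiset.mem_of_mem_erase hu)

/-- Pascal's rule, from `1 + u = 1 - (-u)`. -/
lemma rootSum_pascal {d : ℕ} (hd : 2 ≤ d) {v : ℂ} (hv : IsGeneric d v) (a b : ℤ) :
    rootSum d a (b + 1) v = rootSum d a b v - rootSum d (a + 1) b v := by
  rw [rootSum, rootSum, rootSum, ← Multiset.sum_map_sub]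
  congr 1
  refine Multiset.map_congr rfl fun u hu => ?_
  have h := isGeneric_of_mem_nontrivialRoots hd hv hu
  rw [zpow_add_one₀ h.2.1, zpow_add_one₀ (neg_ne_zero.2 h.1)]
  ring

/-- Powers of `cover d` are constant on fibres, so they may be taken out of a sum over the roots. -/
lemma rootSum_shift {d : ℕ} (hd : 2 ≤ d) {v : ℂ} (hv : IsGeneric d v) (a b c : ℤ) :
    rootSum d (a + c) (b + (d - 1) * c) v = cover d v ^ c * rootSum d a b v := by
  rw [rootSum, rootSum, ← Multiset.sum_map_mul_left]
  congr 1
  refine Multiset.map_congr rfl fun u hu => ?_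
  have h := isGeneric_of_mem_nontrivialRoots hd hv hu
  rw [← cover_eq_of_mem (Multiset.mem_of_mem_erase hu), cover, mul_zpow, ← zpow_natCast,
    ← zpow_mul, zpow_add₀ h.2.1, zpow_add₀ (neg_ne_zero.2 h.1),
    show ((d - 1 : ℕ) : ℤ) = d - 1 by omega]
  ring

/-- Sums of polynomials over the nontrivial roots are polynomials in `v`, up to the factor
`1 + d v`. -/
lemma exists_polynomial_rootSum {d : ℕ} (hd : 2 ≤ d) {a b : ℤ} (ha : 0 ≤ a) (hb : 0 ≤ b) :
    ∃ P : ℂ[X], ∀ v, IsGeneric d v → (1 + d * v) * rootSum d a b v = P.eval v := by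
  obtain ⟨a, rfl⟩ := Int.eq_ofNat_of_zero_le ha
  obtain ⟨b, rfl⟩ := Int.eq_ofNat_of_zero_le hb
  clear ha hb
  induction a generalizing b with
  | zero =>
    induction b using Nat.strong_induction_on with
    | _ k ih =>
      by_cases hk : k < d
      · refine ⟨(if k = 0 then 0 else 1 + (d : ℂ[X]) * X) - (1 + X) ^ k, fun v hv => ?_⟩
        rw [Nat.cast_zero, rootSum_base hd hv hk]
        split_ifs <;> simp
      · obtain ⟨P, hP⟩ := ih (k - 1) (by omega)
        obtain ⟨Q, hQ⟩ := ih (k - d) (by omega)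
        refine ⟨P - (-X * (1 + X) ^ (d - 1)) * Q, fun v hv => ?_⟩
        rw [eval_sub, eval_mul, ← hP v hv, ← hQ v hv]
        have e : (-X * (1 + X) ^ (d - 1) : ℂ[X]).eval v = cover d v := by simp [cover]
        have h : rootSum d 0 k v = rootSum d 0 (k - 1 : ℕ) v -
            cover d v * rootSum d 0 (k - d : ℕ) v := by
          rw [rootSum, rootSum, rootSum, ← Multiset.sum_map_mul_left, ← Multiset.sum_map_sub]
          congr 1
          refine Multiset.map_congr rfl fun u hu => ?_
          have := one_add_pow_of_mem hd (Multiset.mem_of_mem_erase hu) (k - d)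
          rw [show k - d + d = k by omega] at this
          simp only [zpow_natCast]
          rw [this]
          ring
        rw [e, Nat.cast_zero, h]
        ring
  | succ a ih =>
    obtain ⟨P, hP⟩ := ih b
    obtain ⟨Q, hQ⟩ := ih (b + 1)
    refine ⟨P - Q, fun v hv => ?_⟩
    have h := rootSum_pascal hd hv a b
    have h2 := hQ v hv
    push_cast at h2 ⊢
    rw [eval_sub, ← hP v hv, ← h2, h]
    ring

/-- In general the sums are polynomials up to a power of `cover d v`. -/
lemma exists_polynomial_rootSum_mul {d : ℕ} (hd : 2 ≤ d) (a b : ℤ) :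
    ∃ (P : ℂ[X]) (c : ℤ), ∀ v, IsGeneric d v →
      (1 + d * v) * rootSum d a b v = cover d v ^ c * P.eval v := by
  obtain ⟨P, hP⟩ := exists_polynomial_rootSum hd (a := a + (|a| + |b|))
    (b := b + (d - 1) * (|a| + |b|)) (by have := neg_abs_le a; have := abs_nonneg b; omega)
    (by
      have h1 := neg_abs_le b
      have h2 := abs_nonneg a
      have h3 := abs_nonneg b
      have h4 : (1 : ℤ) ≤ d - 1 := by omega
      nlinarith)
  refine ⟨P, -(|a| + |b|), fun v hv => ?_⟩
  rw [← hP v hv, rootSum_shift hd hv, mul_left_comm (1 + (d : ℂ) * v), ← mul_assoc,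
    ← zpow_add₀ hv.cover_ne_zero, neg_add_cancel, zpow_zero, one_mul]

/-! ### The residue of a root sum -/

/-- The coefficient of `w ^ k` in the power series `(1 - w) ^ a`, for integers `a` and `k`. -/
def binomCoeff (a k : ℤ) : ℂ := if k < 0 then 0 else (-1) ^ k.toNat * (Ring.choose a k.toNat : ℤ)

lemma binomCoeff_of_neg (a : ℤ) {k : ℤ} (hk : k < 0) : binomCoeff a k = 0 := if_pos hk

lemma binomCoeff_natCast (a : ℤ) (k : ℕ) : binomCoeff a k = (-1) ^ k * (Ring.choose a k : ℤ) := by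
  rw [binomCoeff, if_neg (by omega), Int.toNat_natCast]

lemma binomCoeff_succ (a k : ℤ) :
    binomCoeff (a + 1) k = binomCoeff a k - binomCoeff a (k - 1) := by
  rcases lt_or_ge k 0 with hk | hk
  · rw [binomCoeff_of_neg _ hk, binomCoeff_of_neg _ hk, binomCoeff_of_neg _ (by omega), sub_zero]
  · obtain ⟨k, rfl⟩ := Int.eq_ofNat_of_zero_le hk
    cases k with
    | zero =>
      rw [binomCoeff_natCast, binomCoeff_natCast, binomCoeff_of_neg _ (by simp)]
      simp
    | succ k =>
      rw [show ((k + 1 : ℕ) : ℤ) - 1 = (k : ℕ) by push_cast; ring, binomCoeff_natCast,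
        binomCoeff_natCast, binomCoeff_natCast, Ring.choose_succ_succ]
      push_cast; ring

lemma choose_neg_succ (n k : ℕ) :
    ((Ring.choose (-(n : ℤ) - 1) k : ℤ) : ℂ) = (-1) ^ k * ((n + k).choose k : ℕ) := by
  rw [show -(n : ℤ) - 1 = -((n : ℤ) + 1) by ring, Ring.choose_neg,
    show (n : ℤ) + 1 + k - 1 = ((n + k : ℕ) : ℤ) by push_cast; ring, Ring.choose_natCast]
  rcases Nat.even_or_odd k with h | h
  · rw [Int.negOnePow_even _ (by exact_mod_cast h), h.neg_one_pow]; simp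
  · rw [Int.negOnePow_odd _ (by exact_mod_cast h), h.neg_one_pow]; simp

/-- Pascal's rule determines a function on `ℤ × ℤ` from its values on a staircase. -/
lemma eq_zero_of_pascal {d : ℕ} (hd : 2 ≤ d) {f : ℤ → ℤ → ℂ}
    (hf : ∀ a b, f a (b + 1) = f a b - f (a + 1) b)
    (h0 : ∀ (c : ℤ) (k : ℕ), k < d → f c ((d - 1) * c + k) = 0) (a b : ℤ) : f a b = 0 := by
  have hd' : (2 : ℤ) ≤ d := by exact_mod_cast hd
  have hup : ∀ (k : ℕ) (c : ℤ), f c ((d - 1) * c + k) = 0 := by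
    intro k
    induction k using Nat.strong_induction_on with
    | _ k ih =>
      intro c
      by_cases hk : k < d
      · exact h0 c k hk
      · have h1 := hf c ((d - 1) * c + (k - 1 : ℕ))
        have h2 := ih (k - 1) (by omega) c
        have h3 := ih (k - d) (by omega) (c + 1)
        rw [show ((d : ℤ) - 1) * (c + 1) + (k - d : ℕ) = (d - 1) * c + (k - 1 : ℕ) by
          push_cast [show d ≤ k by omega, show 1 ≤ k by omega]; ring] at h3
        rw [h2, h3, sub_zero, show ((d : ℤ) - 1) * c + (k - 1 : ℕ) + 1 = (d - 1) * c + k by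
          push_cast [show 1 ≤ k by omega]; ring] at h1
        exact h1
  have hdown : ∀ (k : ℕ) (c : ℤ), f c ((d - 1) * c - k) = 0 := by
    intro k
    induction k using Nat.strong_induction_on with
    | _ k ih =>
      intro c
      rcases Nat.eq_zero_or_pos k with rfl | hk
      · simpa using h0 c 0 (by omega)
      · have hany : ∀ r : ℤ, -(k : ℤ) < r → f (c - 1) ((d - 1) * (c - 1) + r) = 0 := by
          intro r hr
          rcases le_or_gt 0 r with h | h
          · obtain ⟨r, rfl⟩ := Int.eq_ofNat_of_zero_le h
            exact hup r _
          · have := ih (-r).toNat (by omega) (c - 1)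
            rwa [Int.toNat_of_nonneg (by omega), sub_neg_eq_add] at this
        have h1 := hf (c - 1) ((d - 1) * c - k)
        have h2 := hany (d - 1 - k) (by omega)
        have h3 := hany (d - 1 - k + 1) (by omega)
        rw [show ((d : ℤ) - 1) * (c - 1) + (d - 1 - k) = (d - 1) * c - k by ring] at h2
        rw [show ((d : ℤ) - 1) * (c - 1) + (d - 1 - k + 1) = (d - 1) * c - k + 1 by ring] at h3
        rw [h2, h3, sub_add_cancel, zero_sub] at h1
        exact neg_eq_zero.1 h1.symm
  rcases le_or_gt 0 (b - (d - 1) * a) with h | h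
  · have := hup (b - (d - 1) * a).toNat a
    rwa [Int.toNat_of_nonneg h, add_sub_cancel] at this
  · have := hdown (-(b - (d - 1) * a)).toNat a
    rwa [Int.toNat_of_nonneg (by omega), sub_neg_eq_add, add_sub_cancel] at this

lemma cover_zpow {d : ℕ} (hd : 2 ≤ d) (v : ℂ) (c : ℤ) :
    cover d v ^ c = (-1) ^ c * (v ^ c * (1 + v) ^ ((d - 1) * c)) := by
  rw [cover, mul_zpow, neg_eq_neg_one_mul, mul_zpow, ← zpow_natCast, ← zpow_mul,
    show ((d - 1 : ℕ) : ℤ) = d - 1 by omega, mul_assoc]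

lemma hasDerivAt_cover {d : ℕ} (hd : 2 ≤ d) (v : ℂ) :
    HasDerivAt (cover d) (-((1 + v) ^ (d - 2) * (1 + d * v))) v := by
  have h1 : HasDerivAt (fun v : ℂ => 1 + v) 1 v := (hasDerivAt_id v).const_add 1
  have h2 := (hasDerivAt_id v).neg.mul (h1.pow (d - 1))
  obtain ⟨e, rfl⟩ := Nat.exists_eq_add_of_le' hd
  refine h2.congr_deriv ?_
  simp only [Nat.add_succ_sub_one, id, neg_mul, one_mul, Pi.neg_apply, Pi.pow_apply,
    show e + 2 - 2 = e by omega, show e + 2 - 1 = e + 1 by omega]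
  push_cast
  ring

namespace IsLoopAroundZero

variable {p : ℝ} {γ : ℝ → ℂ} {d : ℕ}

lemma cover_ne_zero (hγ : IsLoopAroundZero p γ) {v : ℂ} (hv : v ∈ trace γ) : cover d v ≠ 0 :=
  mul_ne_zero (neg_ne_zero.2 (hγ.ne_zero hv)) (pow_ne_zero _ (hγ.one_add_ne_zero hv))

/-- Root sums times powers of `v`, `1 + v` and `1 + p v` are integrable along the loop, because
they coincide with rational functions off the finitely many points of ramification. -/
lemma loopIntegrable_rootSum (hp : p ≠ 0) (hγ : IsLoopAroundZero p γ) (hd : 2 ≤ d)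
    (a b x y z : ℤ) : LoopIntegrable γ fun v =>
      v ^ x * (1 + v) ^ y * (1 + p * v) ^ z * ((1 + d * v) * rootSum d a b v) := by
  obtain ⟨P, c, hP⟩ := exists_polynomial_rootSum_mul hd a b
  refine LoopIntegrable.congr hγ.simple (finite_not_isGeneric d)
    (g := fun v => v ^ x * (1 + v) ^ y * (1 + p * v) ^ z * (cover d v ^ c * P.eval v)) ?_ ?_
  · intro v _ hv
    rw [hP v (not_not.1 hv)]
  · refine loopIntegrable_of_continuousOn hγ.simple ((hγ.continuousOn_zpow hp x y z).mul
      (ContinuousOn.mul ?_ P.continuous.continuousOn))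
    intro v hv
    refine (ContinuousAt.zpow₀ ?_ c (Or.inl (hγ.cover_ne_zero hv))).continuousWithinAt
    unfold cover
    fun_prop

/-- The integral of `V ^ c * dV`. -/
lemma contourIntegral_cover_zpow (hγ : IsLoopAroundZero p γ) (hd : 2 ≤ d) (c : ℤ) :
    contourIntegral γ (fun v => cover d v ^ c * ((1 + v) ^ (d - 2) * (1 + d * v))) =
      if c = -1 then -1 else 0 := by
  split_ifs with hc
  · subst hc
    have hc0 : ContinuousOn (fun v : ℂ => v⁻¹) (trace γ) := fun v hv =>
      (continuousAt_inv₀ (hγ.ne_zero hv)).continuousWithinAt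
    have hc1 : ContinuousOn (fun v : ℂ => (1 + v)⁻¹) (trace γ) := fun v hv =>
      ((continuousAt_const.add continuousAt_id).inv₀ (hγ.one_add_ne_zero hv)).continuousWithinAt
    have e : ∀ v ∈ trace γ, v ∉ (∅ : Set ℂ) →
        cover d v ^ (-1 : ℤ) * ((1 + v) ^ (d - 2) * (1 + d * v)) =
          -1 * v⁻¹ + (-(d - 1)) * (1 + v)⁻¹ := by
      intro v hv _
      have h1 := hγ.ne_zero hv
      have h2 := hγ.one_add_ne_zero hv
      obtain ⟨e, rfl⟩ := Nat.exists_eq_add_of_le' hd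
      rw [zpow_neg_one, cover, show e + 2 - 1 = e + 1 by omega, show e + 2 - 2 = e by omega]
      push_cast
      field_simp
      ring
    rw [contourIntegral_congr hγ.simple finite_empty e, contourIntegral_add
      ((loopIntegrable_of_continuousOn hγ.simple hc0).const_mul _)
      ((loopIntegrable_of_continuousOn hγ.simple hc1).const_mul _),
      contourIntegral_const_mul, contourIntegral_const_mul]
    have h1 := hγ.winding_zero
    simp only [winding, sub_zero] at h1
    have h2 := hγ.contourIntegral_one_add_zpow (-1)
    simp only [zpow_neg_one] at h2
    rw [h1, h2]; ring
  · have hc' : (c : ℂ) + 1 ≠ 0 := by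
      intro h; apply hc
      have : ((c + 1 : ℤ) : ℂ) = 0 := by push_cast; exact h
      have := Int.cast_eq_zero.1 this
      omega
    refine contourIntegral_eq_zero_of_hasDerivAt hγ.simple
      (F := fun v => -(cover d v ^ (c + 1) / (c + 1))) (fun v hv => ?_) (fun v hv => ?_)
    · have h1 := ((hasDerivAt_zpow (c + 1) (cover d v) (Or.inl (hγ.cover_ne_zero hv))).comp v
        (hasDerivAt_cover hd v)).div_const ((c : ℂ) + 1)
      refine h1.neg.congr_deriv ?_
      rw [add_sub_cancel_right]
      push_cast
      field_simp
    · have h1 : ContinuousAt (fun v => cover d v ^ c) v :=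
        (hasDerivAt_cover hd v).continuousAt.zpow₀ c (Or.inl (hγ.cover_ne_zero hv))
      have h2 : ContinuousAt (fun v : ℂ => (1 + v) ^ (d - 2) * (1 + d * v)) v := by fun_prop
      exact (h1.mul h2).continuousWithinAt

/-- The integral over the loop of a root sum against `dV`. By the residue theorem on the `u`-plane
it is the residue at `u = -1`: the fibre over `V = 0` consists of `u = 0`, which corresponds to the
trivial root, and of `u = -1`. In the proof, Pascal's rule reduces the claim to exponents on a
staircase, where the sum over the roots is explicit. -/
lemma contourIntegral_rootSum (hp : p ≠ 0) (hγ : IsLoopAroundZero p γ) (hd : 2 ≤ d) (a b : ℤ) :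
    contourIntegral γ (fun v => (1 + v) ^ (d - 2) * ((1 + d * v) * rootSum d a b v)) =
      binomCoeff a (1 - d - b) := by
  have hint : ∀ a b, LoopIntegrable γ
      fun v => (1 + v) ^ (d - 2) * ((1 + d * v) * rootSum d a b v) := by
    intro a b
    simpa using hγ.loopIntegrable_rootSum hp hd a b 0 (d - 2 : ℕ) 0
  rw [← sub_eq_zero]
  refine eq_zero_of_pascal hd (f := fun a b => contourIntegral γ
    (fun v => (1 + v) ^ (d - 2) * ((1 + d * v) * rootSum d a b v)) - binomCoeff a (1 - d - b))
    ?_ ?_ a b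
  · intro a b
    have h1 : contourIntegral γ
        (fun v => (1 + v) ^ (d - 2) * ((1 + d * v) * rootSum d a b v)) =
        contourIntegral γ
          (fun v => (1 + v) ^ (d - 2) * ((1 + d * v) * rootSum d a (b + 1) v)) +
        contourIntegral γ
          (fun v => (1 + v) ^ (d - 2) * ((1 + d * v) * rootSum d (a + 1) b v)) := by
      rw [← contourIntegral_add (hint _ _) (hint _ _)]
      refine contourIntegral_congr hγ.simple (finite_not_isGeneric d) fun v _ hv => ?_
      rw [rootSum_pascal hd (not_not.1 hv)]
      ring
    have h2 := binomCoeff_succ a (1 - d - b)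
    rw [show (1 : ℤ) - d - (b + 1) = 1 - d - b - 1 by ring, h1, h2]
    ring
  · intro c k hk
    have hcz : ∀ c y : ℤ, LoopIntegrable γ fun v => cover d v ^ c * (1 + v) ^ y := by
      intro c y
      have := (hγ.loopIntegrable_zpow hp c ((d - 1) * c + y) 0).const_mul ((-1) ^ c)
      refine this.congr hγ.simple finite_empty fun v hv _ => ?_
      rw [cover_zpow hd, zpow_zero, mul_one, zpow_add₀ (hγ.one_add_ne_zero hv)]
      ring
    have hcV : LoopIntegrable γ fun v => cover d v ^ c * ((1 + v) ^ (d - 2) * (1 + d * v)) := by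
      have h1 := ((hcz c (d - 2 : ℕ)).const_mul (1 - d)).add
        ((hcz c ((d - 2 : ℕ) + 1)).const_mul d)
      refine h1.congr hγ.simple finite_empty fun v hv _ => ?_
      rw [zpow_add_one₀ (hγ.one_add_ne_zero hv), zpow_natCast]
      ring
    have h1 : contourIntegral γ (fun v => (1 + v) ^ (d - 2) *
        ((1 + d * v) * rootSum d c ((d - 1) * c + k) v)) =
        (if k = 0 then 0 else 1) * (if c = -1 then -1 else 0) +
          -1 * contourIntegral γ (fun v => cover d v ^ c * (1 + v) ^ ((d : ℤ) - 2 + k)) := by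
      rw [← hγ.contourIntegral_cover_zpow hd, ← contourIntegral_const_mul,
        ← contourIntegral_const_mul, ← contourIntegral_add (hcV.const_mul _)
          ((hcz _ _).const_mul _)]
      refine contourIntegral_congr hγ.simple (finite_not_isGeneric d) fun v hvt hv => ?_
      have hv := not_not.1 hv
      have h1 := rootSum_shift hd hv 0 k c
      rw [zero_add, add_comm (k : ℤ)] at h1
      have h2 := rootSum_base hd hv hk
      rw [h1, mul_left_comm (1 + (d : ℂ) * v), h2, zpow_add₀ (hγ.one_add_ne_zero hvt),
        zpow_natCast, show (d : ℤ) - 2 = (d - 2 : ℕ) by omega, zpow_natCast]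
      split_ifs <;> ring
    have h2 : contourIntegral γ (fun v => cover d v ^ c * (1 + v) ^ ((d : ℤ) - 2 + k)) =
        (-1) ^ c * contourIntegral γ
          (fun v => v ^ c * (1 + v) ^ ((d - 1) * c + ((d : ℤ) - 2 + k))) := by
      rw [← contourIntegral_const_mul]
      refine contourIntegral_congr hγ.simple finite_empty fun v hv _ => ?_
      rw [cover_zpow hd, zpow_add₀ (hγ.one_add_ne_zero hv) ((d - 1) * c)]
      ring
    have hd' : (2 : ℤ) ≤ d := by exact_mod_cast hd
    rw [h1, h2]
    rcases le_or_gt 0 c with hc | hc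
    · rw [hγ.contourIntegral_pow_mul hp hc, if_neg (show c ≠ -1 by omega), binomCoeff_of_neg]
      · ring
      · nlinarith
    · obtain ⟨j, rfl⟩ : ∃ j : ℕ, c = -(j : ℤ) - 1 := ⟨(-c - 1).toNat, by omega⟩
      rw [hγ.contourIntegral_residue hp]
      have hsign : (-1 : ℂ) ^ (-(j : ℤ) - 1) = -(-1) ^ j := by
        rw [zpow_sub₀ (by norm_num), zpow_neg, zpow_natCast]
        rcases Nat.even_or_odd j with h | h <;> simp [h.neg_one_pow]
      rw [hsign]
      rcases Nat.lt_or_ge ((d - 1) * j) k with hjk | hjk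
      · obtain rfl : j = 0 := by
          by_contra hj
          have : (d - 1) * 1 ≤ (d - 1) * j := Nat.mul_le_mul_left _ (by omega)
          omega
        rw [if_neg (by omega), binomCoeff_of_neg _ (by push_cast; ring_nf; omega)]
        simp
      · obtain ⟨e, he⟩ := Nat.exists_eq_add_of_le hjk
        have he' : ((d : ℤ) - 1) * j = k + e := by
          have : ((d - 1 : ℕ) : ℤ) * j = k + e := by exact_mod_cast he
          rwa [show ((d - 1 : ℕ) : ℤ) = d - 1 by omega] at this
        have hδ : (if k = 0 then (0 : ℂ) else 1) * (if -(j : ℤ) - 1 = -1 then -1 else 0) = 0 := by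
          rcases Nat.eq_zero_or_pos j with rfl | hj
          · rw [if_pos (by omega)]; simp
          · rw [if_neg (show -(j : ℤ) - 1 ≠ -1 by omega), mul_zero]
        have e1 : ((d : ℤ) - 1) * (-(j : ℤ) - 1) + (d - 2 + k) = -(e : ℤ) - 1 := by linarith
        have e2 : (1 : ℤ) - d - ((d - 1) * (-(j : ℤ) - 1) + k) = (e : ℕ) := by linarith
        rw [hδ, e1, e2, binomCoeff_natCast, choose_neg_succ, choose_neg_succ, ← mul_assoc,
          ← mul_assoc, ← mul_assoc, ← pow_add, ← two_mul, pow_mul, add_comm e j,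
          ← Nat.choose_symm_add]
        rcases Nat.even_or_odd j with h | h <;> simp [h.neg_one_pow]

end IsLoopAroundZero

/-! ### Properties of the kernel -/

/-- The probability that a free particle jumps `i` times in `t` steps. -/
def hopWeight (p : ℝ) (t i : ℕ) : ℂ := t.choose i * p ^ i * (1 - p) ^ (t - i)

lemma sum_hopWeight_mul_pow (p : ℝ) (t : ℕ) (w : ℂ) :
    ∑ i ∈ Finset.range (t + 1), hopWeight p t i * w ^ i = (1 - p + p * w) ^ t := by
  rw [show (1 - p + p * w : ℂ) = p * w + (1 - p) by ring, add_pow]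
  refine Finset.sum_congr rfl fun i _ => ?_
  rw [hopWeight, mul_pow]; ring

lemma hop_pow_apply (p : ℝ) (t : ℕ) (f : ℤ → ℂ) (x : ℤ) :
    (hop p ^ t) f x = ∑ i ∈ Finset.range (t + 1), hopWeight p t i * f (x + i) := by
  let S : Module.End ℂ (ℤ → ℂ) :=
    { toFun := fun f x => f (x + 1), map_add' := fun _ _ => rfl, map_smul' := fun _ _ => rfl }
  have hS : ∀ (i : ℕ) (f : ℤ → ℂ) (x : ℤ), (S ^ i) f x = f (x + i) := by
    intro i
    induction i with
    | zero => simp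
    | succ i ih =>
      intro f x
      rw [pow_succ', Module.End.mul_apply]
      change (S ^ i) f (x + 1) = _
      rw [ih]; congr 1; push_cast; ring
  have h : hop p = (p : ℂ) • S + (1 - p : ℂ) • 1 := by
    refine LinearMap.ext fun f => funext fun x => ?_
    simp [hop_apply, S]; ring
  have hc : Commute ((p : ℂ) • S) ((1 - p : ℂ) • 1) := (Commute.one_right _).smul_right _
  rw [h, hc.add_pow]
  simp only [LinearMap.sum_apply, Finset.sum_apply]
  refine Finset.sum_congr rfl fun i _ => ?_
  have e : ((p : ℂ) • S) ^ i * ((1 - p : ℂ) • (1 : Module.End ℂ (ℤ → ℂ))) ^ (t - i) *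
      (t.choose i : Module.End ℂ (ℤ → ℂ)) = hopWeight p t i • S ^ i := by
    rw [_root_.smul_pow, _root_.smul_pow, one_pow, smul_mul_smul_comm, mul_one, ← nsmul_eq_mul',
      ← Nat.cast_smul_eq_nsmul ℂ, smul_smul, hopWeight, mul_assoc]
  rw [e, LinearMap.smul_apply, Pi.smul_apply, hS, smul_eq_mul]

lemma grad_pow_single (k : ℕ) (x z : ℤ) :
    (grad ^ k) (Pi.single x 1) z = binomCoeff k (x - z + k) := by
  induction k generalizing z with
  | zero =>
    rcases lt_trichotomy (x - z) 0 with h | h | h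
    · rw [binomCoeff_of_neg _ (by simpa using h), pow_zero, Module.End.one_apply,
        Pi.single_eq_of_ne (by omega)]
    · obtain rfl : x = z := by omega
      have := binomCoeff_natCast 0 0
      simp only [Nat.cast_zero] at this
      simp [this]
    · obtain ⟨r, hr⟩ := Int.eq_ofNat_of_zero_le h.le
      have hr0 : 0 < r := by omega
      rw [show x - z + ((0 : ℕ) : ℤ) = (r : ℕ) by simpa using hr, binomCoeff_natCast, Nat.cast_zero,
        Ring.choose_zero_pos _ hr0, pow_zero, Module.End.one_apply,
        Pi.single_eq_of_ne (by omega)]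
      simp
  | succ k ih =>
    rw [pow_succ', Module.End.mul_apply, grad_apply, ih, ih]
    push_cast
    rw [binomCoeff_succ, show x - (z - 1) + k = x - z + (k + 1) by ring,
      show x - z + ((k : ℤ) + 1) - 1 = x - z + k by ring]

/-- Exponentials are eigenfunctions of `hop` and of `grad`. -/
lemma hop_grad_zpow (p : ℝ) (t k : ℕ) {w : ℂ} (hw : w ≠ 0) (x : ℤ) :
    (hop p ^ t * grad ^ k) (fun x => w ^ x) x =
      (1 - p + p * w) ^ t * (w⁻¹ - 1) ^ k * w ^ x := by
  have hg : ∀ k : ℕ, (grad ^ k) (fun x : ℤ => w ^ x) = (w⁻¹ - 1) ^ k • fun x : ℤ => w ^ x := by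
    intro k
    induction k with
    | zero => simp
    | succ k ih =>
      rw [pow_succ', Module.End.mul_apply, ih, map_smul, pow_succ, mul_smul]
      congr 1
      ext x
      rw [grad_apply, zpow_sub_one₀ hw, Pi.smul_apply, smul_eq_mul]
      ring
  rw [Module.End.mul_apply, hg, hop_pow_apply, ← sum_hopWeight_mul_pow, Finset.sum_mul,
    Finset.sum_mul]
  refine Finset.sum_congr rfl fun i _ => ?_
  rw [Pi.smul_apply, smul_eq_mul, zpow_add₀ hw, zpow_natCast]
  ring

/-- The functions that particle `J` contributes at level `n`. At the last level they are the
transition functions `wave`, at the other levels they are iterated sums of these. -/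
def levelWave (p : ℝ) (d t : ℕ) (J n x : ℤ) : ℂ :=
  ∑ i ∈ Finset.range (t + 1),
    hopWeight p t i * binomCoeff (n - J) (x + n - d + (d - 1) * J - i)

lemma levelWave_sub (p : ℝ) (d t : ℕ) (J n x : ℤ) :
    levelWave p d t J n x - levelWave p d t J n (x - 1) = levelWave p d t J (n + 1) (x - 1) := by
  rw [levelWave, levelWave, levelWave, ← Finset.sum_sub_distrib]
  refine Finset.sum_congr rfl fun i _ => ?_
  rw [show n + 1 - J = n - J + 1 by ring, binomCoeff_succ,
    show x - 1 + n - d + (d - 1) * J - i = x + n - d + (d - 1) * J - i - 1 by ring,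
    show x - 1 + (n + 1) - d + (d - 1) * J - i = x + n - d + (d - 1) * J - i by ring]
  ring

lemma levelWave_eq_zero (p : ℝ) (d t : ℕ) {J n x : ℤ} (h : x + n - d + (d - 1) * J < 0) :
    levelWave p d t J n x = 0 :=
  Finset.sum_eq_zero fun i _ => by rw [binomCoeff_of_neg _ (by omega), mul_zero]

lemma wave_eq_levelWave (p : ℝ) (d t : ℕ) (l : ℤ) {n j : ℕ} (hj : j ≤ n) (x : ℤ) :
    wave p t n (fun i => periodicStart d (l + i)) j x = levelWave p d t (l + j) (l + n) x := by
  rw [wave, Module.End.mul_apply, hop_pow_apply, levelWave]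
  refine Finset.sum_congr rfl fun i _ => ?_
  rw [grad_pow_single, periodicStart]
  congr 2
  · push_cast [hj]; ring
  · push_cast [hj]; ring

/-! ### The convolution powers -/

/-- Pascal's rule for the convolution powers, in the second pair of variables. -/
lemma binomialTerm_sub_right (n₁ x₁ n₂ x₂ : ℤ) :
    (binomialTerm n₁ x₁ n₂ (x₂ - 1) : ℂ) - binomialTerm n₁ x₁ n₂ x₂ =
      binomialTerm n₁ x₁ (n₂ - 1) x₂ + if n₁ + 1 = n₂ ∧ x₂ = x₁ then 1 else 0 := by
  simp only [binomialTerm]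
  rcases lt_or_ge n₁ n₂ with h1 | h1
  · rcases lt_trichotomy x₂ x₁ with h2 | h2 | h2
    · obtain ⟨r, hr⟩ := Int.eq_ofNat_of_zero_le (show 0 ≤ x₁ - x₂ - 1 by omega)
      obtain ⟨m, hm⟩ := Int.eq_ofNat_of_zero_le (show 0 ≤ n₂ - n₁ - 1 by omega)
      rw [if_pos ⟨h1, by omega⟩, if_pos ⟨h1, h2⟩, if_neg (show ¬(n₁ + 1 = n₂ ∧ x₂ = x₁) by omega),
        show x₁ - (x₂ - 1) - 1 = ((r + 1 : ℕ) : ℤ) by push_cast; omega, hr, hm]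
      simp only [Int.toNat_natCast]
      cases m with
      | zero => rw [if_neg (by omega)]; simp
      | succ m =>
        rw [if_pos ⟨by omega, h2⟩, show n₂ - 1 - n₁ - 1 = (m : ℕ) by push_cast at hm; omega,
          Int.toNat_natCast, Nat.choose_succ_succ]
        push_cast; ring
    · subst h2
      rw [if_pos ⟨h1, by omega⟩, if_neg (by omega), if_neg (by omega)]
      have e : (x₂ - (x₂ - 1) - 1).toNat = 0 := by omega
      rw [e]
      by_cases h3 : n₁ + 1 = n₂
      · subst h3; simp
      · obtain ⟨m, hm⟩ : ∃ m : ℕ, (n₂ - n₁ - 1).toNat = m + 1 :=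
          ⟨(n₂ - n₁ - 1).toNat - 1, by omega⟩
        rw [hm]; simp [h3]
    · rw [if_neg (by omega), if_neg (by omega), if_neg (by omega), if_neg (by omega)]; simp
  · rw [if_neg (by omega), if_neg (by omega), if_neg (by omega), if_neg (by omega)]; simp

/-- Pascal's rule for the convolution powers, in the first pair of variables. -/
lemma binomialTerm_sub_left (n₁ x₁ n₂ x₂ : ℤ) :
    (binomialTerm n₁ x₁ n₂ x₂ : ℂ) - binomialTerm n₁ (x₁ - 1) n₂ x₂ =
      binomialTerm (n₁ + 1) (x₁ - 1) n₂ x₂ + if n₁ + 1 = n₂ ∧ x₂ = x₁ - 1 then 1 else 0 := by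
  have htrans : ∀ n₁ x₁ n₂ x₂ r m : ℤ,
      binomialTerm (n₁ + m) (x₁ + r) (n₂ + m) (x₂ + r) = binomialTerm n₁ x₁ n₂ x₂ := by
    intro n₁ x₁ n₂ x₂ r m
    simp only [binomialTerm, add_sub_add_right_eq_sub, add_lt_add_iff_right]
  have h := binomialTerm_sub_right n₁ (x₁ - 1) n₂ x₂
  have e1 := htrans n₁ (x₁ - 1) n₂ (x₂ - 1) 1 0
  have e2 := htrans n₁ (x₁ - 1) (n₂ - 1) x₂ 0 1
  simp only [sub_add_cancel, add_zero] at e1 e2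
  rw [e1, e2, h]

lemma binomialTerm_of_le {n₁ n₂ : ℤ} (h : n₂ ≤ n₁) (x₁ x₂ : ℤ) : binomialTerm n₁ x₁ n₂ x₂ = 0 :=
  if_neg (by omega)

lemma binomialTerm_of_le_right {x₁ x₂ : ℤ} (h : x₁ ≤ x₂) (n₁ n₂ : ℤ) :
    binomialTerm n₁ x₁ n₂ x₂ = 0 :=
  if_neg (by omega)

/-- Pairing the convolution powers with the transition functions gives the functions of the other
levels. -/
lemma sum_binomialTerm_mul_wave (p : ℝ) (d t : ℕ) (l : ℤ) {n j : ℕ} (hj : j ≤ n) {A L : ℤ}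
    (hd : 1 ≤ d) (hA : A + d * (l + n) < d) {n₁ x₁ : ℤ} (hn₁ : n₁ ≤ l + n) (hx₁ : x₁ ≤ L) :
    (if n₁ = l + n then wave p t n (fun i => periodicStart d (l + i)) j x₁ else 0) +
      ∑ x ∈ Finset.Ico A L, (binomialTerm n₁ x₁ (l + n) x : ℂ) *
        wave p t n (fun i => periodicStart d (l + i)) j x = levelWave p d t (l + j) n₁ x₁ := by
  simp only [wave_eq_levelWave p d t l hj]
  obtain ⟨m, rfl⟩ : ∃ m : ℕ, n₁ = l + n - m := ⟨(l + n - n₁).toNat, by omega⟩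
  clear hn₁
  induction m generalizing x₁ with
  | zero =>
    rw [if_pos (by simp), Finset.sum_eq_zero]
    · simp
    · intro x _
      rw [binomialTerm_of_le (by simp)]; simp
  | succ m ih =>
    rw [if_neg (by push_cast; omega), zero_add]
    have hlow : ∀ x₁ ≤ A, ∑ x ∈ Finset.Ico A L,
        (binomialTerm (l + n - (m + 1 : ℕ)) x₁ (l + n) x : ℂ) *
          levelWave p d t (l + j) (l + n) x =
        levelWave p d t (l + j) (l + n - (m + 1 : ℕ)) x₁ := by
      intro x₁ hx
      rw [levelWave_eq_zero, Finset.sum_eq_zero]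
      · intro x hxm
        rw [binomialTerm_of_le_right (hx.trans (Finset.mem_Ico.1 hxm).1)]; simp
      · have h1 : ((d : ℤ) - 1) * (l + j) ≤ (d - 1) * (l + n) :=
          mul_le_mul_of_nonneg_left (by omega) (by omega)
        push_cast
        have h2 : (d : ℤ) * (l + n) = (d - 1) * (l + n) + (l + n) := by ring
        omega
    rcases le_total x₁ A with hx | hx
    · exact hlow x₁ hx
    · induction x₁, hx using Int.leInduction with
      | base => exact hlow A le_rfl
      | succ y hy ihy =>
        have h1 := levelWave_sub p d t (l + j) (l + n - (m + 1 : ℕ)) (y + 1)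
        rw [add_sub_cancel_right, show l + (n : ℤ) - (m + 1 : ℕ) + 1 = l + n - m by
          push_cast; ring, ← ih (x₁ := y) (by omega), ← ihy (by omega), sub_eq_iff_eq_add] at h1
        rw [h1, add_assoc, ← Finset.sum_add_distrib]
        have h2 : (if l + (n : ℤ) - m = l + n then levelWave p d t (l + j) (l + n) y else 0) =
            ∑ x ∈ Finset.Ico A L, (if l + (n : ℤ) - (m + 1 : ℕ) + 1 = l + n ∧ x = y then 1 else 0) *
              levelWave p d t (l + j) (l + n) x := by
          rw [Finset.sum_eq_single y]
          · rw [show l + (n : ℤ) - (m + 1 : ℕ) + 1 = l + n - m by push_cast; ring]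
            simp
          · intro x _ hxy; simp [hxy]
          · intro h; exact absurd (Finset.mem_Ico.2 ⟨hy, by omega⟩) h
        rw [h2, ← Finset.sum_add_distrib]
        refine Finset.sum_congr rfl fun x _ => ?_
        have h3 := binomialTerm_sub_left (l + n - (m + 1 : ℕ)) (y + 1) (l + n) x
        rw [add_sub_cancel_right, sub_eq_iff_eq_add] at h3
        rw [h3, show l + (n : ℤ) - (m + 1 : ℕ) + 1 = l + n - m by push_cast; ring]
        ring

/-! ### The contour part of the kernel -/

/-- Off the points of ramification, the integrand is a combination of root sums. -/
lemma integrand_eq {p : ℝ} {d t : ℕ} (hd : 2 ≤ d) (n₁ x₁ n₂ x₂ : ℤ) {v : ℂ}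
    (hv : IsGeneric d v) : integrand p d t n₁ x₁ n₂ x₂ v =
      ∑ i ∈ Finset.range (t + 1), hopWeight p t i * ((-1) ^ n₂ * (v ^ (-n₂) *
        (1 + v) ^ (x₂ + n₂ - 2) * (1 + p * v) ^ (-(t : ℤ)) *
          ((1 + d * v) * rootSum d n₁ (i - (x₁ + n₁ - 1)) v))) := by
  simp only [integrand, rootSum, ← Multiset.sum_map_mul_left]
  rw [← Multiset.sum_map_sum]
  congr 1
  refine Multiset.map_congr rfl fun u hu => ?_
  have h := isGeneric_of_mem_nontrivialRoots hd hv hu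
  have h1 : (1 + p * u : ℂ) ^ t = ∑ i ∈ Finset.range (t + 1), hopWeight p t i * (1 + u) ^ i := by
    rw [sum_hopWeight_mul_pow]; congr 1; ring
  have hs : (-1 : ℂ) ^ n₂ * v ^ (-n₂) = ((-v) ^ n₂)⁻¹ := by
    rw [neg_eq_neg_one_mul v, mul_zpow, mul_inv, zpow_neg]
    congr 1
    rcases Int.even_or_odd n₂ with h | h <;> simp [h.neg_one_zpow]
  rw [h1, Finset.sum_mul, Finset.sum_mul, Finset.sum_div, Finset.mul_sum]
  refine Finset.sum_congr rfl fun i _ => ?_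
  rw [zpow_sub₀ h.2.1 (i : ℤ), zpow_natCast, zpow_neg (1 + (p : ℂ) * v), zpow_natCast]
  calc _ = hopWeight p t i * (((-v) ^ n₂)⁻¹ * ((1 + v) ^ (x₂ + n₂ - 2) * ((1 + p * v) ^ t)⁻¹ *
        ((1 + d * v) * ((-u) ^ n₁ * ((1 + u) ^ i / (1 + u) ^ (x₁ + n₁ - 1)) / (1 + d * u))))) := by
        simp only [div_eq_mul_inv, mul_inv]; ring
    _ = _ := by rw [← hs]; ring

namespace IsLoopAroundZero

variable {p : ℝ} {γ : ℝ → ℂ} {d : ℕ}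

lemma loopIntegrable_integrand (hp : p ≠ 0) (hγ : IsLoopAroundZero p γ) (hd : 2 ≤ d) (t : ℕ)
    (n₁ x₁ n₂ x₂ : ℤ) : LoopIntegrable γ (integrand p d t n₁ x₁ n₂ x₂) := by
  refine LoopIntegrable.congr hγ.simple (finite_not_isGeneric d)
    (fun v _ hv => integrand_eq hd n₁ x₁ n₂ x₂ (not_not.1 hv)) ?_
  exact LoopIntegrable.sum _ fun i _ =>
    ((hγ.loopIntegrable_rootSum hp hd _ _ _ _ _).const_mul _).const_mul _

/-- The difference equation of the kernel in the second pair of variables. -/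
lemma kernelZero_sub (hp : p ≠ 0) (hγ : IsLoopAroundZero p γ) (hd : 2 ≤ d) (t : ℕ)
    (n₁ x₁ n₂ x₂ : ℤ) : kernelZero p d t γ n₁ x₁ n₂ (x₂ - 1) - kernelZero p d t γ n₁ x₁ n₂ x₂ =
      kernelZero p d t γ n₁ x₁ (n₂ - 1) x₂ := by
  rw [sub_eq_iff_eq_add]
  simp only [kernelZero]
  rw [← contourIntegral_add (hγ.loopIntegrable_integrand hp hd t _ _ _ _)
    (hγ.loopIntegrable_integrand hp hd t _ _ _ _)]
  refine contourIntegral_congr hγ.simple (finite_not_isGeneric d) fun v hvt hv => ?_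
  rw [integrand_eq hd _ _ _ _ (not_not.1 hv), integrand_eq hd _ _ _ _ (not_not.1 hv),
    integrand_eq hd _ _ _ _ (not_not.1 hv), ← Finset.sum_add_distrib]
  refine Finset.sum_congr rfl fun i _ => ?_
  rw [show -(n₂ - 1) = -n₂ + 1 by ring, zpow_add_one₀ (hγ.ne_zero hvt),
    zpow_sub_one₀ (by norm_num : (-1 : ℂ) ≠ 0), show x₂ + (n₂ - 1) - 2 = x₂ - 1 + n₂ - 2 by ring,
    show x₂ + n₂ - 2 = x₂ - 1 + n₂ - 2 + 1 by ring, zpow_add_one₀ (hγ.one_add_ne_zero hvt)]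
  norm_num
  ring

/-- At a level `l` far below zero, the contour part of the kernel vanishes, because the integrand
has no pole at the origin. -/
lemma kernelZero_eq_zero (hp0 : p ≠ 0) (hp1 : p ≠ 1) (hγ : IsLoopAroundZero p γ) (hd : 2 ≤ d)
    (t : ℕ) {n₁ x₁ l : ℤ} (hl : l ≤ n₁) (hx : x₁ + n₁ - 1 + (d - 1) * l ≤ 0) (x₂ : ℤ) :
    kernelZero p d t γ n₁ x₁ l x₂ = 0 := by
  have hpoly : ∀ i : ℕ, ∃ P : ℂ[X], ∀ v, IsGeneric d v →
      (1 + d * v) * rootSum d n₁ (i - (x₁ + n₁ - 1)) v = cover d v ^ l * P.eval v := by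
    intro i
    obtain ⟨P, hP⟩ := exists_polynomial_rootSum hd (a := n₁ - l)
      (b := i - (x₁ + n₁ - 1) - (d - 1) * l) (by omega) (by omega)
    refine ⟨P, fun v hv => ?_⟩
    have h := rootSum_shift hd hv (n₁ - l) (i - (x₁ + n₁ - 1) - (d - 1) * l) l
    rw [sub_add_cancel, sub_add_cancel] at h
    rw [← hP v hv, h]; ring
  choose P hP using hpoly
  have hint : ∀ i, LoopIntegrable γ fun v => (P i).eval v *
      ((1 + v) ^ (x₂ + l - 2 + (d - 1) * l) * (1 + p * v) ^ (-(t : ℤ))) := by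
    intro i
    refine loopIntegrable_of_continuousOn hγ.simple ((P i).continuous.continuousOn.mul ?_)
    simpa using hγ.continuousOn_zpow hp0 0 (x₂ + l - 2 + (d - 1) * l) (-(t : ℤ))
  have e : ∀ v ∈ trace γ, v ∉ {v | ¬ IsGeneric d v} → integrand p d t n₁ x₁ l x₂ v =
      ∑ i ∈ Finset.range (t + 1), hopWeight p t i * ((P i).eval v *
        ((1 + v) ^ (x₂ + l - 2 + (d - 1) * l) * (1 + p * v) ^ (-(t : ℤ)))) := by
    intro v hvt hv
    have hv := not_not.1 hv
    rw [integrand_eq hd _ _ _ _ hv]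
    refine Finset.sum_congr rfl fun i _ => ?_
    have hs : (-1 : ℂ) ^ l * (-1) ^ l = 1 := by rw [← mul_zpow]; simp
    have hvl : v ^ (-l) * v ^ l = 1 := by
      rw [← zpow_add₀ (hγ.ne_zero hvt), neg_add_cancel, zpow_zero]
    rw [hP i v hv, cover_zpow hd, zpow_add₀ (hγ.one_add_ne_zero hvt) (x₂ + l - 2)]
    calc _ = hopWeight p t i * (((-1 : ℂ) ^ l * (-1) ^ l) * (v ^ (-l) * v ^ l) * ((P i).eval v *
        ((1 + v) ^ (x₂ + l - 2) * (1 + v) ^ (((d : ℤ) - 1) * l) *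
          (1 + p * v) ^ (-(t : ℤ))))) := by ring
      _ = _ := by rw [hs, hvl]; ring
  rw [kernelZero, contourIntegral_congr hγ.simple (finite_not_isGeneric d) e,
    contourIntegral_sum _ fun i _ => (hint i).const_mul _]
  refine Finset.sum_eq_zero fun i _ => ?_
  rw [contourIntegral_const_mul, hγ.contourIntegral_eval_mul hp0 hp1, mul_zero]

/-- The pairing of the contour part of the kernel with the transition functions. Summing over `x`
inside the integral replaces the transition function by its exponential transform, which cancels
all factors that depend on `v` only, up to `dV`. -/
lemma sum_kernelZero_mul_wave (hp : p ≠ 0) (hγ : IsLoopAroundZero p γ) (hd : 2 ≤ d) (t : ℕ)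
    (l : ℤ) {n j : ℕ} (hj : j ≤ n) {A L : ℤ} (hA : A ≤ periodicStart d (l + j) - (n - j : ℕ))
    (hL : periodicStart d (l + j) + t < L) (n₁ x₁ : ℤ) :
    ∑ x ∈ Finset.Ico A L, kernelZero p d t γ n₁ x₁ (l + n) x *
        wave p t n (fun i => periodicStart d (l + i)) j x = levelWave p d t (l + j) n₁ x₁ := by
  have h1 : ∑ x ∈ Finset.Ico A L, kernelZero p d t γ n₁ x₁ (l + n) x *
        wave p t n (fun i => periodicStart d (l + i)) j x =
      contourIntegral γ fun v => ∑ x ∈ Finset.Ico A L,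
        wave p t n (fun i => periodicStart d (l + i)) j x *
          integrand p d t n₁ x₁ (l + n) x v := by
    rw [contourIntegral_sum _ fun x _ => (hγ.loopIntegrable_integrand hp hd t _ _ _ _).const_mul _]
    refine Finset.sum_congr rfl fun x _ => ?_
    rw [contourIntegral_const_mul, kernelZero, mul_comm]
  have hint : ∀ a b, LoopIntegrable γ
      fun v => (1 + v) ^ (d - 2) * ((1 + d * v) * rootSum d a b v) := by
    intro a b
    simpa using hγ.loopIntegrable_rootSum hp hd a b 0 (d - 2 : ℕ) 0
  have e : ∀ v ∈ trace γ, v ∉ {v | ¬ IsGeneric d v} → ∑ x ∈ Finset.Ico A L,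
        wave p t n (fun i => periodicStart d (l + i)) j x *
          integrand p d t n₁ x₁ (l + n) x v =
      ∑ i ∈ Finset.range (t + 1), hopWeight p t i * ((1 + v) ^ (d - 2) * ((1 + d * v) *
        rootSum d (n₁ - (l + j)) (i - (x₁ + n₁ - 1) - (d - 1) * (l + j)) v)) := by
    intro v hvt hv
    have hv := not_not.1 hv
    have hv0 := hγ.ne_zero hvt
    have hv1 := hγ.one_add_ne_zero hvt
    have hvp := hγ.one_add_mul_ne_zero hp hvt
    have hw := sum_mul_wave p (t := t) (n := n) (y := fun i => periodicStart d (l + i)) (j := j)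
      hA hL fun x => (1 + v) ^ x
    rw [hop_grad_zpow p t (n - j) hv1] at hw
    simp only [integrand_eq hd _ _ _ _ hv, Finset.mul_sum]
    rw [Finset.sum_comm]
    refine Finset.sum_congr rfl fun i _ => ?_
    have hshift := rootSum_shift hd hv (n₁ - (l + j))
      (i - (x₁ + n₁ - 1) - (d - 1) * (l + j)) (l + j)
    rw [sub_add_cancel, sub_add_cancel, cover_zpow hd] at hshift
    rw [hshift]
    set T := rootSum d (n₁ - (l + j)) (i - (x₁ + n₁ - 1) - (d - 1) * (l + j)) v
    have h2 : ∀ x ∈ Finset.Ico A L, wave p t n (fun i => periodicStart d (l + i)) j x *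
        (hopWeight p t i * ((-1) ^ (l + n : ℤ) * (v ^ (-(l + n : ℤ)) *
          (1 + v) ^ (x + (l + n) - 2) * (1 + p * v) ^ (-(t : ℤ)) * ((1 + d * v) *
            ((-1) ^ (l + j : ℤ) * (v ^ (l + j : ℤ) *
              (1 + v) ^ (((d : ℤ) - 1) * (l + j))) * T))))) =
        (hopWeight p t i * ((-1) ^ (l + n : ℤ) * (v ^ (-(l + n : ℤ)) *
          (1 + v) ^ (l + n - 2 : ℤ) * (1 + p * v) ^ (-(t : ℤ)) * ((1 + d * v) *
            ((-1) ^ (l + j : ℤ) * (v ^ (l + j : ℤ) *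
              (1 + v) ^ (((d : ℤ) - 1) * (l + j))) * T))))) *
        ((1 + v) ^ x * wave p t n (fun i => periodicStart d (l + i)) j x) := by
      intro x _
      rw [show x + (l + n) - 2 = x + (l + n - 2) by ring, zpow_add₀ hv1 x]
      ring
    rw [Finset.sum_congr rfl h2, ← Finset.mul_sum, ← hw]
    have hp1 : (1 - p + p * (1 + v) : ℂ) = 1 + p * v := by ring
    have hp2 : ((1 + v)⁻¹ - 1 : ℂ) = -1 * (v * (1 + v)⁻¹) := by field_simp; ring
    obtain ⟨r, rfl⟩ := Nat.exists_eq_add_of_le hj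
    rw [hp1, hp2, show j + r - j = r by omega, periodicStart, mul_pow, mul_pow,
      zpow_neg (1 + (p : ℂ) * v),
      zpow_natCast]
    have hsgn : (-1 : ℂ) ^ (l + (j + r : ℕ) : ℤ) * (-1) ^ (l + j : ℤ) * (-1) ^ r = 1 := by
      rw [← zpow_natCast, ← zpow_add₀ (by norm_num), ← zpow_add₀ (by norm_num)]
      refine Even.neg_one_zpow ⟨l + j + r, ?_⟩
      push_cast; ring
    have hvv : v ^ (-(l + (j + r : ℕ) : ℤ)) * v ^ (l + j : ℤ) * v ^ r = 1 := by
      rw [← zpow_natCast, ← zpow_add₀ hv0, ← zpow_add₀ hv0]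
      convert zpow_zero v using 2
      push_cast; ring
    have hww : (1 + v) ^ (l + (j + r : ℕ) - 2 : ℤ) * (1 + v) ^ (((d : ℤ) - 1) * (l + j)) *
        ((1 + v)⁻¹ ^ r * (1 + v) ^ (-(d : ℤ) * (l + j - 1))) = (1 + v) ^ (d - 2) := by
      rw [← zpow_natCast (1 + v)⁻¹, inv_zpow', ← zpow_add₀ hv1, ← zpow_add₀ hv1,
        ← zpow_add₀ hv1, ← zpow_natCast (1 + v)]
      congr 1
      push_cast [hd]; ring
    have hpp : ((1 + p * v : ℂ) ^ t)⁻¹ * (1 + p * v) ^ t = 1 :=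
      inv_mul_cancel₀ (pow_ne_zero _ hvp)
    calc _ = hopWeight p t i * (((-1 : ℂ) ^ (l + (j + r : ℕ) : ℤ) * (-1) ^ (l + j : ℤ) * (-1) ^ r) *
          (v ^ (-(l + (j + r : ℕ) : ℤ)) * v ^ (l + j : ℤ) * v ^ r) *
          (((1 + p * v : ℂ) ^ t)⁻¹ * (1 + p * v) ^ t) *
          ((1 + v) ^ (l + (j + r : ℕ) - 2 : ℤ) * (1 + v) ^ (((d : ℤ) - 1) * (l + j)) *
            ((1 + v)⁻¹ ^ r * (1 + v) ^ (-(d : ℤ) * (l + j - 1)))) * ((1 + d * v) * T)) := by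
          ring
      _ = _ := by rw [hsgn, hvv, hpp, hww]; ring
  rw [h1, contourIntegral_congr hγ.simple (finite_not_isGeneric d) e,
    contourIntegral_sum _ fun i _ => (hint _ _).const_mul _, levelWave]
  refine Finset.sum_congr rfl fun i _ => ?_
  rw [contourIntegral_const_mul, hγ.contourIntegral_rootSum hp hd]
  congr 2
  ring

end IsLoopAroundZero

/-! ### The block matrix of the particle system -/

/-- The points with a level in `{0, …, n}` and a position in `[A, L)`. -/
abbrev Site (n : ℕ) (A L : ℤ) : Type := Fin (n + 1) × ↥(Finset.Ico A L)

section Blocks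

variable {n : ℕ} {A L : ℤ}

/-- The transition from one level to the next, to a smaller position. -/
def stepMatrix (n : ℕ) (A L : ℤ) : Matrix (Site n A L) (Site n A L) ℂ :=
  .of fun s s' => if (s.1 : ℕ) + 1 = s'.1 ∧ (s'.2 : ℤ) < s.2 then 1 else 0

/-- The entrance of chain `i`, at an arbitrary position of level `i`. -/
def entryMatrix (n : ℕ) (A L : ℤ) : Matrix (Fin (n + 1)) (Site n A L) ℂ :=
  .of fun i s => if i = s.1 then 1 else 0

/-- The transition functions of the particles, at the last level. -/
def exitMatrix (p : ℝ) (d t : ℕ) (l : ℤ) (n : ℕ) (A L : ℤ) :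
    Matrix (Site n A L) (Fin (n + 1)) ℂ :=
  .of fun s j => if (s.1 : ℕ) = n then wave p t n (fun i => periodicStart d (l + i)) j s.2 else 0

/-- The projection onto the positions below the thresholds `α`. -/
def cutMatrix (α : ℕ → ℤ) (n : ℕ) (A L : ℤ) : Matrix (Site n A L) (Site n A L) ℂ :=
  .diagonal fun s => if (s.2 : ℤ) < α s.1 then 1 else 0

/-- The numbers of chains that start at level `i` and end at a given site, as a matrix. -/
def chainMatrix (α : ℕ → ℤ) (n : ℕ) (A L : ℤ) : Matrix (Fin (n + 1)) (Site n A L) ℂ :=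
  .of fun i s => chain L α s.1 i s.2

lemma vecMul_stepMatrix (κ : ℕ → ℤ → ℂ) (s : Site n A L) :
    Matrix.vecMul (fun s : Site n A L => κ s.1 s.2) (stepMatrix n A L) s =
      if (s.1 : ℕ) = 0 then 0 else ∑ z ∈ Finset.Ioo (s.2 : ℤ) L, κ (s.1 - 1) z := by
  simp only [Matrix.vecMul, dotProduct, stepMatrix, Matrix.of_apply]
  rw [Fintype.sum_prod_type]
  split_ifs with h
  · refine Finset.sum_eq_zero fun i _ => Finset.sum_eq_zero fun x _ => ?_
    rw [if_neg (by simp only; omega), mul_zero]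
  · have hs := s.1.2
    rw [Finset.sum_eq_single (⟨s.1 - 1, by omega⟩ : Fin (n + 1))]
    · have h1 : (s.1 : ℕ) - 1 + 1 = s.1 := by omega
      simp only [h1, true_and, mul_ite, mul_one, mul_zero]
      rw [Finset.sum_coe_sort (Finset.Ico A L)
        (fun z => if (s.2 : ℤ) < z then κ (s.1 - 1) z else 0), ← Finset.sum_filter]
      refine Finset.sum_congr ?_ fun _ _ => rfl
      ext z
      have := Finset.mem_Ico.1 s.2.2
      simp only [Finset.mem_filter, Finset.mem_Ico, Finset.mem_Ioo]
      omega
    · intro i _ hi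
      refine Finset.sum_eq_zero fun x _ => ?_
      rw [if_neg, mul_zero]
      rintro ⟨h1, -⟩
      have h2 : (i : ℕ) + 1 = s.1 := h1
      exact hi (Fin.ext (show (i : ℕ) = s.1 - 1 by omega))
    · simp

lemma one_sub_cutMatrix (α : ℕ → ℤ) : 1 - cutMatrix α n A L =
    Matrix.diagonal fun s : Site n A L => if α s.1 ≤ (s.2 : ℤ) then 1 else 0 := by
  rw [cutMatrix, ← Matrix.diagonal_one, Matrix.diagonal_sub]
  congr 1
  ext s
  by_cases h : α s.1 ≤ (s.2 : ℤ)
  · rw [if_neg (by omega), if_pos h, sub_zero]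
  · rw [if_pos (by omega), if_neg h, sub_self]

/-- The recursion for the numbers of chains that stay above the thresholds. -/
lemma chainMatrix_mul (α : ℕ → ℤ) :
    chainMatrix α n A L * (1 - stepMatrix n A L * (1 - cutMatrix α n A L)) =
      entryMatrix n A L * (1 - cutMatrix α n A L) := by
  rw [one_sub_cutMatrix, Matrix.mul_sub, Matrix.mul_one, sub_eq_iff_eq_add, ← Matrix.mul_assoc]
  ext i s
  rw [Matrix.add_apply, Matrix.mul_diagonal, Matrix.mul_diagonal]
  have h1 : (chainMatrix α n A L * stepMatrix n A L) i s =
      Matrix.vecMul (fun s : Site n A L => chain L α s.1 i s.2) (stepMatrix n A L) s := rfl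
  rw [h1, vecMul_stepMatrix fun k x => chain L α k i x]
  obtain ⟨⟨k, hk⟩, x⟩ := s
  simp only [chainMatrix, entryMatrix, Matrix.of_apply, Fin.ext_iff]
  cases k with
  | zero => simp [chain]
  | succ k =>
    simp only [chain, Nat.add_sub_cancel, Nat.succ_ne_zero, if_false]
    split_ifs <;> simp

lemma det_one_sub_stepMatrix_mul (α : ℕ → ℤ) :
    (1 - stepMatrix n A L * (1 - cutMatrix α n A L)).det = 1 := by
  refine det_one_sub_of_level (fun s => (s.1 : ℕ)) fun a b h => ?_
  rw [one_sub_cutMatrix, Matrix.mul_diagonal, stepMatrix, Matrix.of_apply, if_neg (by omega),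
    zero_mul]

lemma cutMatrix_const : cutMatrix (fun _ => A) n A L = 0 := by
  rw [cutMatrix, ← Matrix.diagonal_zero]
  congr 1
  ext s
  exact if_neg (not_lt.2 (Finset.mem_Ico.1 s.2.2).1)

lemma chainMatrix_const_mul :
    chainMatrix (fun _ => A) n A L * (1 - stepMatrix n A L) = entryMatrix n A L := by
  have h := chainMatrix_mul (n := n) (A := A) (L := L) fun _ => A
  simpa only [cutMatrix_const, sub_zero, Matrix.mul_one] using h

lemma det_one_sub_stepMatrix : (1 - stepMatrix n A L).det = 1 := by
  have h := det_one_sub_stepMatrix_mul (n := n) (A := A) (L := L) fun _ => A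
  simpa only [cutMatrix_const, sub_zero, Matrix.mul_one] using h

/-- Functions of the level only are combinations of the rows of the entry matrix. -/
lemma exists_vecMul_entryMatrix {f : ℕ → ℤ → ℂ}
    (hf : ∀ k ≤ n, ∀ x, A < x → x < L → f k (x - 1) = f k x) :
    ∃ b, (fun s : Site n A L => f s.1 s.2) = Matrix.vecMul b (entryMatrix n A L) := by
  refine ⟨fun i => f i A, funext fun s => ?_⟩
  have h1 : Matrix.vecMul (fun i : Fin (n + 1) => f i A) (entryMatrix n A L) s = f s.1 A := by
    simp [Matrix.vecMul, dotProduct, entryMatrix]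
  rw [h1]
  have h2 : ∀ x, A ≤ x → x < L → f s.1 x = f s.1 A := by
    intro x hx
    induction x, hx using Int.leInduction with
    | base => simp
    | succ x hx ih =>
      intro hxL
      have := hf s.1 (by omega) (x + 1) (by omega) hxL
      rw [← ih (by omega), ← this, add_sub_cancel_right]
  have := Finset.mem_Ico.1 s.2.2
  exact h2 _ this.1 this.2

lemma chainMatrix_mul_exitMatrix (p : ℝ) (d t : ℕ) (l : ℤ) (α : ℕ → ℤ) :
    chainMatrix α n A L * exitMatrix p d t l n A L = Matrix.of fun i j : Fin (n + 1) =>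
      ∑ x ∈ Finset.Ico A L, chain L α n i x *
        wave p t n (fun i => periodicStart d (l + i)) j x := by
  ext i j
  simp only [Matrix.mul_apply, chainMatrix, exitMatrix, Matrix.of_apply]
  rw [Fintype.sum_prod_type, Finset.sum_eq_single (Fin.last n)]
  · simp only [Fin.val_last, if_true]
    exact Finset.sum_coe_sort (Finset.Ico A L) fun x =>
      chain L α n i x * wave p t n (fun i => periodicStart d (l + i)) j x
  · intro k _ hk
    refine Finset.sum_eq_zero fun x _ => ?_
    rw [if_neg, mul_zero]
    intro h
    exact hk (Fin.ext h)
  · simp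

lemma sum_mul_exitMatrix (p : ℝ) (d t : ℕ) (l : ℤ) (κ : ℕ → ℤ → ℂ) (j : Fin (n + 1)) :
    Matrix.vecMul (fun s : Site n A L => κ s.1 s.2) (exitMatrix p d t l n A L) j =
      ∑ x ∈ Finset.Ico A L, κ n x * wave p t n (fun i => periodicStart d (l + i)) j x := by
  simp only [Matrix.vecMul, dotProduct, exitMatrix, Matrix.of_apply]
  rw [Fintype.sum_prod_type, Finset.sum_eq_single (Fin.last n)]
  · simp only [Fin.val_last, if_true]
    exact Finset.sum_coe_sort (Finset.Ico A L) fun x =>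
      κ n x * wave p t n (fun i => periodicStart d (l + i)) j x
  · intro k _ hk
    refine Finset.sum_eq_zero fun x _ => ?_
    rw [if_neg, mul_zero]
    intro h
    exact hk (Fin.ext h)
  · simp

end Blocks

lemma strictAnti_start {d : ℕ} (hd : 2 ≤ d) (l : ℤ) :
    StrictAnti fun i : ℕ => periodicStart d (l + i) :=
  fun i j hij => strictAnti_periodicStart hd (by omega)

lemma le_start_sub {d : ℕ} (hd : 2 ≤ d) {l A : ℤ} {n j : ℕ} (hj : j ≤ n)
    (hA : A + d * (l + n) < d) : A ≤ periodicStart d (l + j) - (n - j : ℕ) := by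
  obtain ⟨r, rfl⟩ := Nat.exists_eq_add_of_le hj
  rw [periodicStart, show j + r - j = r by omega]
  push_cast at hA
  have h1 : (2 : ℤ) ≤ d := by exact_mod_cast hd
  have h2 : (r : ℤ) * 1 ≤ r * d := mul_le_mul_of_nonneg_left (by omega) (by omega)
  nlinarith

lemma start_add_lt {d : ℕ} (hd : 2 ≤ d) {l L : ℤ} {t : ℕ} (hL : periodicStart d l + t < L)
    (j : ℕ) : periodicStart d (l + j) + t < L := by
  have h := (strictAnti_start hd l).antitone (Nat.zero_le j)
  simp only [Nat.cast_zero, add_zero] at h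
  omega

/-- With thresholds that are certainly passed, the determinant of the pairing is one, as the
probability of the sure event. -/
lemma det_chainMatrix_const_mul (p : ℝ) {d : ℕ} (hd : 2 ≤ d) (t : ℕ) {l A L : ℤ} {n : ℕ}
    (hA : A + d * (l + n) < d) (hL : periodicStart d l + t < L) :
    (chainMatrix (fun _ => A) n A L * exitMatrix p d t l n A L).det = 1 := by
  have h := sum_table_indicator p t n (fun _ => A) (strictAnti_start hd l)
    (fun j hj => le_start_sub hd hj hA) (L := L) (by simpa using hL)
  rw [chainMatrix_mul_exitMatrix, ← h]
  have h1 : ∀ c : Fin t → Fin (n + 1) → Bool,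
      ∀ k ≤ n, A ≤ seqPath (fun i => periodicStart d (l + i)) (extendTable c) t k := by
    intro c k hk
    have h2 := le_start_sub hd hk hA
    have h3 := le_seqPath (fun i => periodicStart d (l + i)) (extendTable c) t k
    omega
  simp only [if_pos (h1 _), mul_one]
  have h2 := Finset.prod_univ_sum
    (fun _ : Fin t => (Finset.univ : Finset (Fin (n + 1) → Bool)))
    fun _ c => ∏ i, coinWeight p (c i)
  rw [Fintype.piFinset_univ] at h2
  rw [← h2]
  simp [sum_prod_coinWeight]

namespace IsLoopAroundZero

variable {p : ℝ} {γ : ℝ → ℂ} {d : ℕ}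

/-- The rows of `kernelZero` vanish far to the left: they solve a linear system with unique
solution, which is homogeneous because the pairing with the transition functions vanishes there. -/
lemma kernelZero_eq_zero_of_low (hp0 : p ≠ 0) (hp1 : p ≠ 1) (hγ : IsLoopAroundZero p γ)
    (hd : 2 ≤ d) (t : ℕ) {l : ℤ} {n : ℕ} {n₁ x₁ n₂ : ℤ} (h1 : l ≤ n₁) (h1' : n₁ ≤ l + n)
    (h2 : l ≤ n₂) (h2' : n₂ ≤ l + n) (hx : x₁ + d * (l + n) < d)
    (hx' : x₁ + n₁ - 1 + (d - 1) * l ≤ 0) (x₂ : ℤ) : kernelZero p d t γ n₁ x₁ n₂ x₂ = 0 := by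
  set A : ℤ := min x₂ (d - d * (l + n) - 1) with hAdef
  set L : ℤ := max (x₂ + 1) (periodicStart d l + t + 1) with hLdef
  have hA : A + d * (l + n) < d := by
    have : A ≤ d - d * (l + n) - 1 := min_le_right _ _
    omega
  have hL : periodicStart d l + t < L := by
    have : periodicStart d l + t + 1 ≤ L := le_max_right _ _
    omega
  let κ : ℕ → ℤ → ℂ := fun k x => kernelZero p d t γ n₁ x₁ (l + k) x
  obtain ⟨b, hb⟩ := exists_vecMul_entryMatrix (n := n) (A := A) (L := L)
    (f := fun k x => κ k x - if k = 0 then 0 else ∑ z ∈ Finset.Ioo x L, κ (k - 1) z) (by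
      intro k hk x _ hxL
      rcases Nat.eq_zero_or_pos k with rfl | hk0
      · simp only [κ, Nat.cast_zero, add_zero, hγ.kernelZero_eq_zero hp0 hp1 hd t h1 hx', if_true]
      · have h := hγ.kernelZero_sub hp0 hd t n₁ x₁ (l + k) x
        simp only [if_neg hk0.ne', sum_Ioo_sub_one hxL, κ]
        rw [show l + ((k - 1 : ℕ) : ℤ) = l + k - 1 by omega, ← h]
        ring)
  have hrow := row_eq_zero (G₀ := chainMatrix (fun _ => A) n A L)
    (Ψ := exitMatrix p d t l n A L) (k := fun s => κ s.1 s.2) (b := b) chainMatrix_const_mul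
    det_one_sub_stepMatrix (det_chainMatrix_const_mul p hd t hA hL) ?_ ?_
  · have hk : (n₂ - l).toNat < n + 1 := by omega
    have hxm : x₂ ∈ Finset.Ico A L := by
      rw [Finset.mem_Ico]
      exact ⟨min_le_left _ _, lt_of_lt_of_le (by omega : x₂ < x₂ + 1) (le_max_left _ _)⟩
    have := congrFun hrow (⟨(n₂ - l).toNat, hk⟩, ⟨x₂, hxm⟩)
    simpa only [κ, Int.toNat_of_nonneg (show 0 ≤ n₂ - l by omega), add_sub_cancel,
      Pi.zero_apply] using this
  · ext j
    rw [sum_mul_exitMatrix, hγ.sum_kernelZero_mul_wave hp0 hd t l (by omega)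
      (le_start_sub hd (by omega) hA) (start_add_lt hd hL j), levelWave_eq_zero]
    · rfl
    · have h3 : ((d : ℤ) - 1) * (l + j) ≤ (d - 1) * (l + n) :=
        mul_le_mul_of_nonneg_left (by omega) (by omega)
      have h4 : (d : ℤ) * (l + n) = (d - 1) * (l + n) + (l + n) := by ring
      omega
  · rw [← hb]
    ext s
    rw [Matrix.vecMul_sub, Matrix.vecMul_one, Pi.sub_apply, vecMul_stepMatrix]

/-- The gap determinant of the chains is the determinant of the cut kernel on a finite box. -/
lemma det_chainMatrix_mul (hp0 : p ≠ 0) (hp1 : p ≠ 1) (hγ : IsLoopAroundZero p γ)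
    (hd : 2 ≤ d) (t : ℕ) {l A L : ℤ} {n : ℕ} (hA : A + d * (l + n) < d)
    (hL : periodicStart d l + t < L) (α : ℕ → ℤ)
    (hα : ∀ k ≤ n, α k + (l + n) + (d - 1) * l ≤ 0) :
    (chainMatrix α n A L * exitMatrix p d t l n A L).det =
      (1 - cutMatrix α n A L * (Matrix.of fun s s' : Site n A L =>
        kernel p d t γ (l + (s.1 : ℕ)) s.2 (l + (s'.1 : ℕ)) s'.2) * cutMatrix α n A L).det := by
  set K : Matrix (Site n A L) (Site n A L) ℂ := Matrix.of fun s s' : Site n A L =>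
        kernel p d t γ (l + (s.1 : ℕ)) s.2 (l + (s'.1 : ℕ)) s'.2 with hK
  -- Up to the unit diagonal, `1 - K` consists of the rows `κ s`.
  let κ : Site n A L → ℕ → ℤ → ℂ := fun s k x =>
    binomialTerm (l + (s.1 : ℕ)) s.2 (l + k) x -
      kernelZero p d t γ (l + (s.1 : ℕ)) s.2 (l + k) x
  have hrowK : ∀ s, (1 - K) s = Pi.single s 1 + fun s' : Site n A L => κ s s'.1 s'.2 := by
    intro s
    ext s'
    rw [Matrix.sub_apply, Matrix.one_apply, Pi.add_apply, Pi.single_apply, hK, Matrix.of_apply,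
      kernel]
    simp only [κ, eq_comm (a := s)]
    ring
  -- The difference equations of the two parts of the kernel: the defect of the row depends on the
  -- level only.
  have hconst : ∀ s : Site n A L, (s.2 : ℤ) < α s.1 → ∃ b : Fin (n + 1) → ℂ,
      Matrix.vecMul ((1 - K) s) (1 - stepMatrix n A L) =
        Pi.single s 1 + Matrix.vecMul b (entryMatrix n A L) := by
    intro s hs
    have hs1 := s.1.2
    obtain ⟨b, hb⟩ := exists_vecMul_entryMatrix (n := n) (A := A) (L := L)
      (f := fun k x => -(if (s.1 : ℕ) + 1 = k ∧ x < s.2 then 1 else 0) +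
        (κ s k x - if k = 0 then 0 else ∑ z ∈ Finset.Ioo x L, κ s (k - 1) z)) (by
        intro k hk x _ hxL
        rcases Nat.eq_zero_or_pos k with rfl | hk0
        · have hz : ∀ x, κ s 0 x = 0 := by
            intro x
            have h3 := hα s.1 (by omega)
            have e : l + ((0 : ℕ) : ℤ) = l := by simp
            simp only [κ, e]
            rw [binomialTerm_of_le (by omega),
              hγ.kernelZero_eq_zero hp0 hp1 hd t (by omega) (by omega)]
            simp
          simp [hz]
        · have h := hγ.kernelZero_sub hp0 hd t (l + (s.1 : ℕ)) s.2 (l + k) x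
          have h' := binomialTerm_sub_right (l + (s.1 : ℕ)) s.2 (l + k) x
          have h4 : (if (s.1 : ℕ) + 1 = k ∧ x - 1 < s.2 then (1 : ℂ) else 0) =
              (if (s.1 : ℕ) + 1 = k ∧ x < s.2 then 1 else 0) +
                if l + ((s.1 : ℕ) : ℤ) + 1 = l + k ∧ x = s.2 then 1 else 0 := by
            by_cases h5 : (s.1 : ℕ) + 1 = k
            · have h6 : l + ((s.1 : ℕ) : ℤ) + 1 = l + k := by omega
              simp only [h5, h6, true_and]
              rcases lt_trichotomy x s.2 with h7 | h7 | h7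
              · rw [if_pos (by omega), if_pos h7, if_neg (by omega), add_zero]
              · rw [if_pos (by omega), if_neg (by omega), if_pos h7, zero_add]
              · rw [if_neg (by omega), if_neg (by omega), if_neg (by omega), add_zero]
            · rw [if_neg (by omega), if_neg (by omega), if_neg (by omega), add_zero]
          simp only [if_neg hk0.ne', sum_Ioo_sub_one hxL, κ]
          rw [show l + ((k - 1 : ℕ) : ℤ) = l + k - 1 by omega, h4]
          linear_combination h' - h)
    refine ⟨b, ?_⟩
    rw [← hb, hrowK, Matrix.add_vecMul, Matrix.single_one_vecMul]
    ext s'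
    rw [Pi.add_apply, Matrix.vecMul_sub, Matrix.vecMul_one, Pi.sub_apply, vecMul_stepMatrix,
      Pi.add_apply, Matrix.row_apply, Matrix.sub_apply, Matrix.one_apply, Pi.single_apply,
      stepMatrix, Matrix.of_apply]
    simp only [eq_comm (a := s)]
    ring
  choose! b hb using hconst
  refine det_gap (B := Matrix.of fun s i => -b s i) ?_ (chainMatrix_mul α) chainMatrix_const_mul
    (det_one_sub_stepMatrix_mul α) det_one_sub_stepMatrix
    (det_chainMatrix_const_mul p hd t hA hL) ?_ ?_
  · rw [cutMatrix, Matrix.diagonal_mul_diagonal]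
    congr 1
    ext s
    split_ifs <;> simp
  · ext s j
    rw [cutMatrix, Matrix.diagonal_mul, Matrix.zero_apply]
    split_ifs with hs
    · have h1 : ((1 - K) * exitMatrix p d t l n A L : Matrix (Site n A L) (Fin (n + 1)) ℂ) s j =
          Matrix.vecMul ((1 - K) s) (exitMatrix p d t l n A L) j := rfl
      have hs1 := s.1.2
      have hs2 := Finset.mem_Ico.1 s.2.2
      have hS := sum_binomialTerm_mul_wave p d t l (j := j) (n := n) (by omega) (by omega) hA
        (n₁ := l + (s.1 : ℕ)) (x₁ := s.2) (L := L) (by omega) (by omega)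
      have hR := hγ.sum_kernelZero_mul_wave hp0 hd t l (n := n) (j := j) (by omega)
        (le_start_sub hd (by omega) hA) (start_add_lt hd hL j) (l + (s.1 : ℕ)) s.2
      rw [h1, hrowK, Matrix.add_vecMul, Pi.add_apply, Matrix.single_one_vecMul,
        sum_mul_exitMatrix, one_mul, Matrix.row_apply, exitMatrix, Matrix.of_apply]
      simp only [κ, sub_mul, Finset.sum_sub_distrib]
      rw [hR, ← hS]
      simp
    · rw [zero_mul]
  · ext s s'
    rw [cutMatrix, Matrix.diagonal_mul, Matrix.diagonal_apply]
    split_ifs with hs h1 h1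
    · subst h1
      have h2 := congrFun (hb s hs) s
      rw [Matrix.add_apply, one_mul]
      have h3 : ((1 - K) * (1 - stepMatrix n A L)) s s =
        Matrix.vecMul ((1 - K) s) (1 - stepMatrix n A L) s := rfl
      have h4 : ((Matrix.of fun s i => -b s i) * entryMatrix n A L) s s =
        Matrix.vecMul (-(b s)) (entryMatrix n A L) s := rfl
      rw [h3, h2, h4, Matrix.neg_vecMul]
      simp
    · have h2 := congrFun (hb s hs) s'
      rw [Matrix.add_apply, one_mul]
      have h3 : ((1 - K) * (1 - stepMatrix n A L)) s s' =
        Matrix.vecMul ((1 - K) s) (1 - stepMatrix n A L) s' := rfl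
      have h4 : ((Matrix.of fun s i => -b s i) * entryMatrix n A L) s s' =
        Matrix.vecMul (-(b s)) (entryMatrix n A L) s' := rfl
      rw [h3, h2, h4, Matrix.neg_vecMul]
      simp [Ne.symm h1]
    · rw [zero_mul]
    · rw [zero_mul]

end IsLoopAroundZero

/-! ### Fredholm determinants of finite rank -/

section Fredholm

variable {R S X : Type*} [Fintype R] [DecidableEq R] [Fintype S] [DecidableEq S]

/-- The finite Fredholm expansion. -/
lemma det_one_sub_eq_sum_minors (M : Matrix R R ℂ) :
    (1 - M).det = ∑ n ∈ Finset.range (Fintype.card R + 1), (-1) ^ n *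
      ∑ s ∈ (Finset.univ : Finset R).powersetCard n,
        (M.submatrix (Subtype.val : s → R) (Subtype.val : s → R)).det := by
  set P : ℂ[X] := (1 + (X : ℂ[X]) • M.map C).det with hP
  have hcoeff := fun k => Matrix.coeff_det_one_add_X_smul_eq_sum_minors M k
  have hdeg : P.natDegree < Fintype.card R + 1 := by
    refine Nat.lt_succ_of_le (natDegree_le_iff_coeff_eq_zero.2 fun k hk => ?_)
    rw [hcoeff, Finset.powersetCard_eq_empty.2 (by simpa using hk), Finset.sum_empty]
  have heval : P.eval (-1) = (1 - M).det := by
    rw [hP, ← coe_evalRingHom, RingHom.map_det]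
    congr 1
    ext i j
    simp only [RingHom.mapMatrix_apply, Matrix.map_apply, Matrix.add_apply, Matrix.smul_apply,
      Matrix.sub_apply, Matrix.one_apply, smul_eq_mul, map_add, coe_evalRingHom]
    split_ifs <;> simp [sub_eq_add_neg]
  rw [← heval, eval_eq_sum_range' hdeg]
  exact Finset.sum_congr rfl fun k _ => by rw [hcoeff, mul_comm]

/-- Each principal minor of size `n` occurs `n!` times in the multiple sum. -/
lemma sum_fredholmMinor (M : R → R → ℂ) (n : ℕ) :
    ∑ y, fredholmMinor M n y = n ! * ∑ s ∈ (Finset.univ : Finset R).powersetCard n,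
      ((Matrix.of M).submatrix (Subtype.val : s → R) (Subtype.val : s → R)).det := by
  have h0 : ∀ y : Fin n → R, ¬ Function.Injective y → fredholmMinor M n y = 0 := by
    intro y hy
    obtain ⟨i, j, hij, hne⟩ : ∃ i j, y i = y j ∧ i ≠ j := by
      simpa only [Function.Injective, not_forall, exists_prop] using hy
    refine Matrix.det_zero_of_row_eq hne ?_
    ext k
    simp [hij]
  have h1 : ∑ y, fredholmMinor M n y =
      ∑ y ∈ Finset.univ.filter (Function.Injective : (Fin n → R) → Prop),
        fredholmMinor M n y := by
    rw [Finset.sum_filter_of_ne]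
    intro y _ hy
    by_contra h
    exact hy (h0 y h)
  have h2 : ∀ y ∈ Finset.univ.filter (Function.Injective : (Fin n → R) → Prop),
      Finset.univ.image y ∈ (Finset.univ : Finset R).powersetCard n := by
    intro y hy
    rw [Finset.mem_powersetCard]
    refine ⟨Finset.subset_univ _, ?_⟩
    rw [Finset.card_image_of_injective _ (Finset.mem_filter.1 hy).2, Finset.card_univ,
      Fintype.card_fin]
  rw [h1, ← Finset.sum_fiberwise_of_maps_to h2, Finset.mul_sum]
  refine Finset.sum_congr rfl fun s hs => ?_
  have hcard : Fintype.card (Fin n) = Fintype.card s := by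
    rw [Fintype.card_coe, (Finset.mem_powersetCard.1 hs).2, Fintype.card_fin]
  have h3 : ∑ e : Fin n ≃ s, fredholmMinor M n (fun i => e i) =
      ∑ y ∈ (Finset.univ.filter (Function.Injective : (Fin n → R) → Prop)).filter
        (fun y => Finset.univ.image y = s), fredholmMinor M n y := by
    refine Finset.sum_bij (fun e _ i => (e i : R)) ?_ ?_ ?_ fun _ _ => rfl
    · intro e _
      simp only [Finset.mem_filter, Finset.mem_univ, true_and]
      refine ⟨Subtype.val_injective.comp e.injective, ?_⟩
      ext x
      simp only [Finset.mem_image, Finset.mem_univ, true_and]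
      exact ⟨fun ⟨i, hi⟩ => hi ▸ (e i).2, fun hx => ⟨e.symm ⟨x, hx⟩, by simp⟩⟩
    · intro e _ e' _ h
      ext i
      exact congrFun h i
    · intro y hy
      simp only [Finset.mem_filter, Finset.mem_univ, true_and] at hy
      have hm : ∀ i, y i ∈ s := fun i => hy.2 ▸ Finset.mem_image_of_mem _ (Finset.mem_univ i)
      have hinj : Function.Injective fun i => (⟨y i, hm i⟩ : s) := fun i j h =>
        hy.1 (congrArg Subtype.val h)
      exact ⟨Equiv.ofBijective _ ((Fintype.bijective_iff_injective_and_card _).2 ⟨hinj, hcard⟩),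
        Finset.mem_univ _, rfl⟩
  rw [← h3, Finset.sum_congr rfl fun e _ => ?_, Finset.sum_const, Finset.card_univ,
    Fintype.card_equiv (Fintype.equivOfCardEq hcard), Fintype.card_fin, nsmul_eq_mul]
  exact Matrix.det_submatrix_equiv_self e
    ((Matrix.of M).submatrix (Subtype.val : s → R) (Subtype.val : s → R))

/-- If the minors of `A` that leave a finite set vanish, then the Fredholm determinant is the
determinant of a finite matrix. The finite set is the range of `g`. -/
lemma hasFredholmDet_of_finite {A : X → X → ℂ} {g : R → X} (hg : Function.Injective g)
    (h : ∀ n (y : Fin n → X) i, y i ∉ range g → fredholmMinor A n y = 0) :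
    HasFredholmDet A (1 - Matrix.of fun a b => A (g a) (g b)).det := by
  have hinj : ∀ n, Function.Injective fun (y : Fin n → R) i => g (y i) :=
    fun n y y' hy => funext fun i => hg (congrFun hy i)
  have hzero : ∀ n, ∀ y ∉ range fun (y : Fin n → R) i => g (y i), fredholmMinor A n y = 0 := by
    intro n y hy
    by_contra hne
    have h1 : ∀ i, ∃ a, g a = y i := by
      intro i
      by_contra h2
      exact hne (h n y i h2)
    choose z hz using h1
    exact hy ⟨z, funext hz⟩
  refine ⟨fun n => ((hinj n).summable_iff (hzero n)).1 (Summable.of_finite), ?_⟩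
  have hsum : ∀ n, ∑' y, fredholmMinor A n y =
      n ! * ∑ s ∈ (Finset.univ : Finset R).powersetCard n, ((Matrix.of fun a b =>
        A (g a) (g b)).submatrix (Subtype.val : s → R) (Subtype.val : s → R)).det := by
    intro n
    rw [← (hinj n).tsum_eq (Function.support_subset_iff'.2 (hzero n)), tsum_fintype]
    exact sum_fredholmMinor (fun a b => A (g a) (g b)) n
  rw [det_one_sub_eq_sum_minors]
  simp only [hsum]
  have hterm : ∀ (n : ℕ) (z : ℂ), (-1) ^ n / (n ! : ℂ) * (n ! * z) = (-1) ^ n * z := by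
    intro n z
    have : (n ! : ℂ) ≠ 0 := by exact_mod_cast n.factorial_ne_zero
    field_simp
  simp only [hterm]
  refine hasSum_sum_of_ne_finset_zero fun n hn => ?_
  rw [Finset.powersetCard_eq_empty.2 (by simpa using hn), Finset.sum_empty, mul_zero]

/-- Indices whose columns vanish may be dropped from `det (1 - N)`. -/
lemma det_one_sub_submatrix {N : Matrix S S ℂ} {e : R → S} (he : Function.Injective e)
    (hN : ∀ s, ∀ s' ∉ range e, N s s' = 0) : (1 - N.submatrix e e).det = (1 - N).det := by
  let P : Matrix R S ℂ := .of fun r s => if e r = s then 1 else 0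
  have h1 : N.submatrix id e * P = N := by
    ext s s'
    simp only [P, Matrix.mul_apply, Matrix.submatrix_apply, id, Matrix.of_apply, mul_ite, mul_one,
      mul_zero]
    by_cases h : s' ∈ range e
    · obtain ⟨r, rfl⟩ := h
      simp [he.eq_iff]
    · rw [hN s s' h]
      exact Finset.sum_eq_zero fun r _ => if_neg fun hr => h ⟨r, hr⟩
  have h2 : P * N.submatrix id e = N.submatrix e e := by
    ext r r'
    simp [P, Matrix.mul_apply]
  rw [← h2, Matrix.det_one_sub_mul_comm, h1]

end Fredholm

/-! ### The joint distribution -/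

/-- The minors of the cut kernel vanish if a point lies outside of the box: if it lies too far to
the left, then the row of the leftmost point vanishes, and otherwise its own row does. -/
lemma IsLoopAroundZero.fredholmMinor_cutKernel_eq_zero {p : ℝ} {γ : ℝ → ℂ} (hp0 : p ≠ 0)
    (hp1 : p ≠ 1) (hγ : IsLoopAroundZero p γ) {d : ℕ} (hd : 2 ≤ d) (t : ℕ) {m : ℕ}
    {σ : Fin m → ℤ} {a : Fin m → ℝ} {l A L : ℤ} {n : ℕ} (hl : ∀ j, l ≤ σ j)
    (hn : ∀ j, σ j ≤ l + n) (hA : A + d * (l + n) < d) (hA' : A + (l + n) + (d - 1) * l ≤ 0)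
    (hL : ∀ j, ⌈a j⌉ ≤ L) {N : ℕ} (y : Fin N → Fin m × ℤ) {i : Fin N}
    (hi : (y i).2 ∉ Ico A L) : fredholmMinor (cutKernel p d t γ σ a) N y = 0 := by
  by_cases h : (y i).2 < A
  · obtain ⟨r, -, hr⟩ := Finset.exists_min_image Finset.univ (fun i => (y i).2)
      ⟨i, Finset.mem_univ i⟩
    refine Matrix.det_eq_zero_of_row_eq_zero r fun k => ?_
    have h1 := hr i (Finset.mem_univ i)
    have h2 := hr k (Finset.mem_univ k)
    have h3 := hn (y r).1
    rw [Matrix.of_apply, cutKernel, kernel, binomialTerm_of_le_right h2,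
      hγ.kernelZero_eq_zero_of_low hp0 hp1 hd t (hl _) (hn _) (hl _) (hn _) (by omega) (by omega)]
    simp
  · have h1 : ¬ ((y i).2 : ℝ) < a (y i).1 := by
      have h2 := hL (y i).1
      rw [mem_Ico] at hi
      rw [← Int.lt_ceil]
      omega
    refine Matrix.det_eq_zero_of_row_eq_zero i fun k => ?_
    rw [Matrix.of_apply, cutKernel, if_neg h1, zero_mul, zero_mul]

/-- The joint distribution function as a finite determinant. The levels on which the infinite and
the truncated system may differ have no effective threshold. -/
lemma measureReal_eq_det {Ω : Type*} [MeasurableSpace Ω] (μ : Measure Ω) [IsProbabilityMeasure μ]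
    {p : ℝ} {d : ℕ} (hd : 2 ≤ d) {ξ : Ω → ℕ → ℤ → Bool} (hξ : IsCoinField μ p ξ) (t : ℕ)
    {l A L : ℤ} {n : ℕ} (hA : A + d * (l + n) < d) (hL : periodicStart d l + t < L) (α : ℕ → ℤ)
    (hα : ∀ k < influence t, α k ≤ A) :
    ((μ.real {ω | ∀ k ≤ n, α k ≤ position (periodicStart d) (ξ ω) t (l + k)} : ℝ) : ℂ) =
      (chainMatrix α n A L * exitMatrix p d t l n A L).det := by
  have h1 := measureReal_eq_sum_coins μ hξ t (n + 1) l fun c => ∀ k ≤ n,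
    α k ≤ seqPath (fun i => periodicStart d (l + i)) (extendTable c) t k
  rw [sum_table_indicator p t n α (strictAnti_start hd l) (fun j hj => le_start_sub hd hj hA)
    (L := L) (by simpa using hL)] at h1
  rw [chainMatrix_mul_exitMatrix, ← h1]
  congr 3
  ext ω
  refine forall₂_congr fun k hk => ?_
  have h2 : seqPath (fun i => periodicStart d (l + i))
      (extendTable fun (s : Fin t) (i : Fin (n + 1)) => ξ ω s (l + (i : ℕ))) t k =
      seqPath (fun i => periodicStart d (l + i)) (fun r i => ξ ω r (l + i)) t k := by
    refine seqPath_congr _ fun r hr j hj => ?_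
    simp only [extendTable, extendCoins]
    rw [dif_pos hr, dif_pos (by omega)]
  rw [h2]
  by_cases h3 : influence t ≤ k
  · rw [position_eq_seqPath hd _ _ _ _ h3]
  -- Near the right end the two dynamics may differ, but there the threshold is passed at time `0`.
  · have h4 := hα k (by omega)
    have h5 := le_start_sub hd hk hA
    have h6 := le_position (periodicStart d) (ξ ω) t (l + k)
    have h7 := le_seqPath (fun i => periodicStart d (l + i)) (fun r i => ξ ω r (l + i)) t k
    exact iff_of_true (by omega) (by omega)

/-- The theorem for a choice of the truncation: the first label `l`, the number `n + 1` of levels,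
and the bounds `A` and `L` of the box. The other levels get the threshold `A`. -/
lemma IsLoopAroundZero.hasFredholmDet_cutKernel {p : ℝ} {γ : ℝ → ℂ} (hp0 : p ≠ 0) (hp1 : p ≠ 1)
    (hγ : IsLoopAroundZero p γ) {Ω : Type*} [MeasurableSpace Ω] (μ : Measure Ω)
    [IsProbabilityMeasure μ] {d : ℕ} (hd : 2 ≤ d) {ξ : Ω → ℕ → ℤ → Bool} (hξ : IsCoinField μ p ξ)
    (t : ℕ) {m : ℕ} {σ : Fin m → ℤ} (hσ : Function.Injective σ) {a : Fin m → ℝ} {l A L : ℤ}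
    {n : ℕ} (hl : ∀ j, l + influence t ≤ σ j) (hn : ∀ j, σ j ≤ l + n)
    (hA : A + d * (l + n) < d) (hA' : A + (l + n) + (d - 1) * l ≤ 0)
    (ha : ∀ j, ⌈a j⌉ + (l + n) + (d - 1) * l ≤ 0) (hL : periodicStart d l + t < L)
    (hL' : ∀ j, ⌈a j⌉ ≤ L) : HasFredholmDet (cutKernel p d t γ σ a)
      (μ.real (⋂ k, {ω | a k ≤ (position (periodicStart d) (ξ ω) t (σ k) : ℝ)}) : ℂ) := by
  have hl' : ∀ j, l ≤ σ j := fun j => by have := hl j; omega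
  let τ : Fin m → ℕ := fun j => (σ j - l).toNat
  have hτ : ∀ j, l + (τ j : ℤ) = σ j := fun j => by have := hl' j; simp only [τ]; omega
  have hτi : Function.Injective τ := fun i j h => hσ (by rw [← hτ i, ← hτ j, h])
  let α : ℕ → ℤ := Function.extend τ (fun j => ⌈a j⌉) fun _ => A
  have hα1 : ∀ j, α (τ j) = ⌈a j⌉ := fun j => hτi.extend_apply _ _ j
  have hα2 : ∀ k, (¬ ∃ j, τ j = k) → α k = A := fun k hk => Function.extend_apply' _ _ k hk
  have hevent : (⋂ k, {ω | a k ≤ (position (periodicStart d) (ξ ω) t (σ k) : ℝ)}) =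
      {ω | ∀ k ≤ n, α k ≤ position (periodicStart d) (ξ ω) t (l + k)} := by
    ext ω
    simp only [mem_iInter, mem_ofPred_eq]
    constructor
    · intro h k hk
      by_cases hj : ∃ j, τ j = k
      · obtain ⟨j, rfl⟩ := hj
        rw [hα1, hτ, Int.ceil_le]
        exact h j
      · rw [hα2 k hj]
        have h1 := le_start_sub hd hk hA
        have h2 := le_position (periodicStart d) (ξ ω) t (l + k)
        omega
    · intro h j
      have h1 := hτ j
      have h2 := hn j
      have h3 := h (τ j) (by omega)
      rwa [hα1, hτ, Int.ceil_le] at h3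
  rw [hevent, measureReal_eq_det μ hd hξ t hA hL α (fun k hk => (hα2 k (by
      rintro ⟨j, rfl⟩
      have h1 := hτ j
      have h2 := hl j
      omega)).le), hγ.det_chainMatrix_mul hp0 hp1 hd t hA hL α (fun k _ => by
      by_cases hj : ∃ j, τ j = k
      · obtain ⟨j, rfl⟩ := hj
        rw [hα1]
        exact ha j
      · rw [hα2 k hj]
        exact hA')]
  let e : Fin m × ↥(Finset.Ico A L) → Site n A L := fun y =>
    (⟨τ y.1, by have h1 := hτ y.1; have h2 := hn y.1; omega⟩, y.2)
  have he : Function.Injective e := by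
    rintro ⟨j, x⟩ ⟨j', x'⟩ h
    simp only [e, Prod.mk.injEq, Fin.mk.injEq] at h
    exact Prod.ext (hτi h.1) h.2
  have hdet := hasFredholmDet_of_finite (A := cutKernel p d t γ σ a)
    (g := fun y : Fin m × ↥(Finset.Ico A L) => (y.1, (y.2 : ℤ)))
    (fun y y' h => by
      simp only [Prod.mk.injEq] at h
      exact Prod.ext h.1 (Subtype.ext h.2))
    (fun N y i hi => hγ.fredholmMinor_cutKernel_eq_zero hp0 hp1 hd t hl' hn hA hA' hL' y
      (i := i) fun h => hi ⟨((y i).1, ⟨(y i).2, Finset.mem_Ico.2 h⟩), rfl⟩)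
  rw [← det_one_sub_submatrix he]
  · convert hdet using 3
    ext y y'
    rw [Matrix.submatrix_apply, cutMatrix, Matrix.mul_diagonal, Matrix.diagonal_mul]
    simp only [e, Matrix.of_apply, cutKernel, hτ, hα1, Int.lt_ceil]
  · rintro s ⟨k, x⟩ hk
    rw [cutMatrix, Matrix.mul_diagonal, if_neg, mul_zero]
    have h1 : α k = A := hα2 k (by
      rintro ⟨j, hj⟩
      exact hk ⟨(j, x), Prod.ext (Fin.ext hj) rfl⟩)
    have h2 := Finset.mem_Ico.1 x.2
    simp only [h1]
    omega

end SequentialTASEP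

end

open SequentialTASEP in
theorem theorem2p1 {Ω : Type*} [MeasurableSpace Ω] (μ : Measure Ω) [IsProbabilityMeasure μ]
    (p : ℝ) (hp0 : 0 < p) (hp1 : p < 1) (d : ℕ) (hd : 2 ≤ d)
    (ξ : Ω → ℕ → ℤ → Bool) (hξ : IsCoinField μ p ξ)
    (t m : ℕ) (σ : Fin m → ℤ) (hσ : StrictMono σ) (a : Fin m → ℝ)
    (γ : ℝ → ℂ) (hγ : IsLoopAroundZero p γ) :
    (∀ n₁ x₁ n₂ x₂ : ℤ, IntervalIntegrable
      (fun s => integrand p d t n₁ x₁ n₂ x₂ (γ s) * deriv γ s) volume 0 1) ∧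
    HasFredholmDet (cutKernel p d t γ σ a)
      (μ.real (⋂ k, {ω | a k ≤ (position (periodicStart d) (ξ ω) t (σ k) : ℝ)}) : ℂ) := by
  refine ⟨fun n₁ x₁ n₂ x₂ => hγ.loopIntegrable_integrand hp0.ne' hd t n₁ x₁ n₂ x₂, ?_⟩
  obtain ⟨B, hB⟩ := (Set.finite_range σ).bddBelow
  obtain ⟨H, hH⟩ := (Set.finite_range σ).bddAbove
  obtain ⟨c, hc⟩ := (Set.finite_range fun j => ⌈a j⌉).bddAbove
  replace hB : ∀ j, B ≤ σ j := fun j => hB ⟨j, rfl⟩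
  replace hH : ∀ j, σ j ≤ H := fun j => hH ⟨j, rfl⟩
  replace hc : ∀ j, ⌈a j⌉ ≤ c := fun j => hc ⟨j, rfl⟩
  -- The system is cut so far to the right that the particles in question do not notice it, and that
  -- the contour part of the kernel vanishes at the first level.
  obtain ⟨l, hl1, hl2, hl3, hl4⟩ : ∃ l : ℤ, l + influence t ≤ B ∧ l ≤ H ∧ l ≤ 0 ∧ c + H + l ≤ 0 :=
    ⟨min (B - influence t) (min H (min 0 (-(c + H)))), by omega, by omega, by omega, by omega⟩
  obtain ⟨n, rfl⟩ : ∃ n : ℕ, H = l + n := ⟨(H - l).toNat, by omega⟩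
  have hdl : ((d : ℤ) - 1) * l ≤ l := by
    have h1 : (2 : ℤ) ≤ d := by exact_mod_cast hd
    nlinarith
  obtain ⟨A, hA1, hA2⟩ : ∃ A : ℤ, A + d * (l + n) < d ∧ A ≤ c :=
    ⟨min (d - d * (l + n) - 1) c, by omega, by omega⟩
  obtain ⟨L, hL1, hL2⟩ : ∃ L : ℤ, periodicStart d l + t < L ∧ c ≤ L :=
    ⟨max (periodicStart d l + t + 1) c, by omega, by omega⟩
  refine hγ.hasFredholmDet_cutKernel hp0.ne' hp1.ne μ hd hξ t hσ.injective
    (fun j => hl1.trans (hB j)) hH hA1 (by omega) (fun j => ?_) hL1 fun j => (hc j).trans hL2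
  have := hc j
  omega
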